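/- As $n\to\infty$ through the positive integers (with $\log$ the natural logarithm, and $a_n\sim b_n$ meaning $a_n/b_n\to1$), the following hold. (i) $\displaystyle \sum_{k=0}^n \binom{n}{k}(-1)^k e^{\sqrt{k}} \sim -\frac{1}{\sqrt{\pi\log n}}$; (ii) $\displaystyle \sum_{k=0}^n \binom{n}{k}(-1)^k e^{-\sqrt{k}} \sim \frac{1}{\sqrt{\pi\log n}}$; (iii) $\displaystyle \sum_{k=1}^n \binom{n}{k}(-1)^k e^{1/k} \sim -\frac{e^{2\sqrt{\log n}}}{2\sqrt{\pi}\,(\log n)^{1/4}}$; (iv) $\displaystyle \sum_{k=1}^n \binom{n}{k}(-1)^k e^{-1/k} = -\frac{\cos\left(2\sqrt{\log n}-\tfrac{\pi}{4}\right)}{\sqrt{\pi}\,(\log n)^{1/4}} + o\left((\log n)^{-1/4}\right)$. -/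

import Mathlib

open Filter Asymptotics

open Set MeasureTheory Topology

/-! If `f k = k ∫ e^{-kt} F(t) dt`, then `sum_choose_laplace` gives `∑_{k≥1} C(n,k)(-1)^k f(k) = -E
F(M)`, where `M` is the maximum of `n` independent standard exponentials. Since `M - log n` is
tight, a function `F` that is regular enough near `log n` satisfies `E F(M) ≈ F(log n)`;
`tendsto_integral_maxExpDensity` makes this precise by dominated convergence. Each sum thus reduces
to finding `F` and its behaviour at infinity.

For `1 - e^{-√k}`, `F` is `erf(1/(2√t)) ~ 1/√(πt)`; for `e^{1/k}` and `e^{-1/k}` it is `I₀(2√t)` and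
`J₀(2√t)`. The Bessel asymptotics come from Laplace's method, for `J₀` after moving the contour to a
path of descent (`tendsto_besselI`, `tendsto_besselJ`).

The growth of `e^{√k}` rules out this route. Instead, `e^{√k} + e^{-√k} = 2 cosh √k` is an entire
function of `k` of order `1/2`, whose `n`-th difference is super-exponentially small
(`abs_sum_choose_cosh_sqrt_le`). So (i) is (ii) with the sign reversed. -/

/-! ### Binomial sums as expectations of a maximum of exponentials. -/

/-- The density of the maximum of `n` independent standard exponential variables. -/
noncomputable def maxExpDensity (n : ℕ) (t : ℝ) : ℝ :=
  n * (1 - Real.exp (-t)) ^ (n - 1) * Real.exp (-t)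

theorem continuous_maxExpDensity (n : ℕ) : Continuous (maxExpDensity n) := by
  unfold maxExpDensity; fun_prop

theorem maxExpDensity_nonneg (n : ℕ) {t : ℝ} (ht : 0 ≤ t) : 0 ≤ maxExpDensity n t := by
  have h : 0 ≤ 1 - Real.exp (-t) := by
    rw [sub_nonneg]; exact Real.exp_le_one_iff.2 (by linarith)
  unfold maxExpDensity; positivity

/-- Binomial expansion of the power `n - 1`, with the absorption identity `n C(n-1,k) = (k+1)
C(n,k+1)` shifting the index by one. -/
theorem maxExpDensity_eq_sum (n : ℕ) (t : ℝ) :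
    maxExpDensity n t = -∑ k ∈ Finset.Icc 1 n,
      (n.choose k : ℝ) * (-1) ^ k * (k * Real.exp (-(k * t))) := by
  unfold maxExpDensity
  rcases n with _ | m
  · simp
  have h3 := Finset.sum_Ico_add' (fun k : ℕ => ((m + 1).choose k : ℝ) *
    (-1) ^ k * (k * Real.exp (-(k * t)))) 0 (m + 1) 1
  rw [show Finset.Icc 1 (m + 1) = Finset.Ico (0 + 1) (m + 1 + 1) by ext; simp, ← h3]
  have h : (1 - Real.exp (-t)) = -Real.exp (-t) + 1 := by ring
  rw [h, add_pow]
  simp only [Nat.add_sub_cancel, Finset.mul_sum, Finset.sum_mul, ← Finset.sum_neg_distrib,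
    ← Finset.range_eq_Ico]
  refine Finset.sum_congr rfl fun k _ => ?_
  have h1 : ((m + 1 : ℕ) : ℝ) * (m.choose k) = ((m + 1).choose (k + 1)) * ((k + 1 : ℕ) : ℝ) := by
    exact_mod_cast Nat.add_one_mul_choose_eq m k
  have h2 : Real.exp (-(((k + 1 : ℕ) : ℝ) * t)) = Real.exp (-t) ^ k * Real.exp (-t) := by
    rw [← pow_succ, ← Real.exp_nat_mul]; ring_nf
  rw [h2, neg_pow]
  linear_combination ((-1) ^ k * Real.exp (-t) ^ k * Real.exp (-t)) * h1

/-- A bound uniform in `n` around `log n`. With `y = n e^{-t}` the density is at most `y`, which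
suffices to the right; to the left it is at most `y e^{-y/2} ≤ 8/y`, where `n ≥ 2` gives `n - 1 ≥
n/2`. -/
theorem maxExpDensity_le {n : ℕ} (hn : 2 ≤ n) {t : ℝ} (ht : 0 ≤ t) :
    maxExpDensity n t ≤ 8 * Real.exp (-|t - Real.log n|) := by
  have hn0 : (0 : ℝ) < n := by positivity
  set y : ℝ := Real.exp (-(t - Real.log n)) with hy
  have hy0 : 0 < y := Real.exp_pos _
  have hyn : n * Real.exp (-t) = y := by
    rw [hy, show -(t - Real.log n) = Real.log n + -t by ring, Real.exp_add, Real.exp_log hn0]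
  have h0 : 0 ≤ 1 - Real.exp (-t) := by
    rw [sub_nonneg]; exact Real.exp_le_one_iff.2 (by linarith)
  have hw : maxExpDensity n t = y * (1 - Real.exp (-t)) ^ (n - 1) := by
    rw [← hyn]; unfold maxExpDensity; ring
  have hw1 : maxExpDensity n t ≤ y := by
    rw [hw]
    exact mul_le_of_le_one_right hy0.le (pow_le_one₀ h0 (by linarith [Real.exp_pos (-t)]))
  rcases le_total 0 (t - Real.log n) with h | h
  · rw [abs_of_nonneg h]; linarith
  · rw [abs_of_nonpos h, neg_neg]
    have h3 : (1 - Real.exp (-t)) ^ (n - 1) ≤ Real.exp (-(y / 2)) := by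
      calc (1 - Real.exp (-t)) ^ (n - 1) ≤ Real.exp (-Real.exp (-t)) ^ (n - 1) :=
            pow_le_pow_left₀ h0 (Real.one_sub_le_exp_neg _) _
        _ = Real.exp (((n - 1 : ℕ) : ℝ) * -Real.exp (-t)) := (Real.exp_nat_mul _ _).symm
        _ ≤ _ := by
            apply Real.exp_le_exp.2
            rw [Nat.cast_sub (by omega), ← hyn]
            have : (2 : ℝ) ≤ n := by exact_mod_cast hn
            push_cast
            nlinarith [Real.exp_pos (-t)]
    -- The quadratic Taylor term of `e^{y/2}` is the source of the constant 8.
    have h4 : y ^ 2 / 8 ≤ Real.exp (y / 2) := by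
      have := Real.quadratic_le_exp_of_nonneg (show 0 ≤ y / 2 by positivity)
      nlinarith
    have h5 : Real.exp (t - Real.log n) = y⁻¹ := by rw [hy, ← Real.exp_neg, neg_neg]
    rw [hw, h5]
    calc y * (1 - Real.exp (-t)) ^ (n - 1) ≤ y * Real.exp (-(y / 2)) := by gcongr
      _ ≤ 8 * y⁻¹ := by
        rw [Real.exp_neg, ← div_eq_mul_inv, ← div_eq_mul_inv,
          div_le_div_iff₀ (Real.exp_pos _) hy0]
        nlinarith

/-- A function on the half-line which is continuous and of exponential order at most `1/2`. -/
structure HalfExpOrder (F : ℝ → ℝ) : Prop where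
  cont : ContinuousOn F (Ioi 0)
  bound : ∃ C, ∀ t > 0, |F t| ≤ C * Real.exp (t / 2)

theorem HalfExpOrder.integrableOn {F : ℝ → ℝ} (hF : HalfExpOrder F) {k : ℝ} (hk : 1 ≤ k) :
    IntegrableOn (fun t => Real.exp (-(k * t)) * F t) (Ioi 0) := by
  obtain ⟨C, hC⟩ := hF.bound
  have h1 : IntegrableOn (fun t : ℝ => C * Real.exp (-(1 / 2) * t)) (Ioi 0) :=
    (exp_neg_integrableOn_Ioi 0 (by norm_num)).const_mul C
  refine Integrable.mono' h1 ?_ ?_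
  · refine ContinuousOn.aestronglyMeasurable ?_ measurableSet_Ioi
    exact (by fun_prop : Continuous fun t : ℝ => Real.exp (-(k * t))).continuousOn.mul hF.cont
  · filter_upwards [ae_restrict_mem measurableSet_Ioi] with t ht
    have ht : 0 < t := ht
    rw [norm_mul, Real.norm_eq_abs, Real.norm_eq_abs, Real.abs_exp]
    have hC0 : 0 ≤ C := by
      have := (abs_nonneg _).trans (hC t ht)
      exact nonneg_of_mul_nonneg_left this (Real.exp_pos _)
    calc Real.exp (-(k * t)) * |F t| ≤ Real.exp (-(1 * t)) * (C * Real.exp (t / 2)) := by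
          gcongr; exact hC t ht
      _ = C * (Real.exp (-(1 * t)) * Real.exp (t / 2)) := by ring
      _ = _ := by rw [← Real.exp_add]; ring_nf

theorem HalfExpOrder.integrableOn_maxExpDensity_mul {F : ℝ → ℝ} (hF : HalfExpOrder F) (n : ℕ) :
    IntegrableOn (fun t => maxExpDensity n t * F t) (Ioi 0) := by
  simp only [maxExpDensity_eq_sum, ← Finset.sum_neg_distrib, Finset.sum_mul]
  refine integrable_finsetSum _ fun k hk => ?_
  have hk1 : (1 : ℝ) ≤ k := by exact_mod_cast (Finset.mem_Icc.1 hk).1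
  refine ((hF.integrableOn hk1).const_mul (-(n.choose k * (-1) ^ k * k))).congr ?_
  exact Eventually.of_forall fun t => by ring

/-- The binomial sum of a Laplace transform as an expectation of the maximum of exponentials. -/
theorem sum_choose_laplace {F f : ℝ → ℝ} (hF : HalfExpOrder F)
    (hf : ∀ k : ℝ, 1 ≤ k → k * ∫ t in Ioi 0, Real.exp (-(k * t)) * F t = f k) (n : ℕ) :
    ∑ k ∈ Finset.Icc 1 n, (n.choose k : ℝ) * (-1) ^ k * f k =
      -∫ t in Ioi 0, maxExpDensity n t * F t := by
  have h : ∀ t, maxExpDensity n t * F t = ∑ k ∈ Finset.Icc 1 n,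
      -((n.choose k : ℝ) * (-1) ^ k * k) * (Real.exp (-(k * t)) * F t) := by
    intro t
    rw [maxExpDensity_eq_sum, ← Finset.sum_neg_distrib, Finset.sum_mul]
    exact Finset.sum_congr rfl fun k _ => by ring
  simp only [h]
  rw [integral_finsetSum, ← Finset.sum_neg_distrib]
  · refine Finset.sum_congr rfl fun k hk => ?_
    have hk1 : (1 : ℝ) ≤ k := by exact_mod_cast (Finset.mem_Icc.1 hk).1
    rw [integral_const_mul, ← hf k hk1]
    ring
  · intro k hk
    have hk1 : (1 : ℝ) ≤ k := by exact_mod_cast (Finset.mem_Icc.1 hk).1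
    exact (hF.integrableOn hk1).const_mul _

theorem halfExpOrder_const (c : ℝ) : HalfExpOrder fun _ => c where
  cont := continuousOn_const
  bound := ⟨|c|, fun t ht => le_mul_of_one_le_right (abs_nonneg _)
    (Real.one_le_exp (by linarith))⟩

theorem integral_exp_neg_mul_Ioi {k : ℝ} (hk : 0 < k) :
    ∫ t in Ioi (0 : ℝ), Real.exp (-(k * t)) = 1 / k := by
  have := integral_exp_mul_Ioi (a := -k) (by linarith) 0
  simpa [neg_mul] using this

theorem sum_choose_Icc {n : ℕ} (hn : n ≠ 0) :
    ∑ k ∈ Finset.Icc 1 n, (n.choose k : ℝ) * (-1) ^ k = -1 := by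
  have h1 : ∑ k ∈ Finset.range (n + 1), (n.choose k : ℝ) * (-1) ^ k = 0 := by
    have := Int.alternating_sum_range_choose_of_ne hn
    have h2 : (((∑ m ∈ Finset.range (n + 1), (-1) ^ m * (n.choose m : ℤ)) : ℤ) : ℝ) = 0 := by
      rw [this]; simp
    push_cast at h2
    simpa [mul_comm] using h2
  rw [Finset.range_eq_Ico, Finset.sum_eq_sum_Ico_succ_bot (by omega)] at h1
  have h3 : Finset.Ico (0 + 1) (n + 1) = Finset.Icc 1 n := by ext; simp
  rw [h3] at h1
  simp at h1
  linarith

/-- The case `F = 1` of `sum_choose_laplace`, so nothing has to be integrated by hand. -/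
theorem integral_maxExpDensity {n : ℕ} (hn : n ≠ 0) : ∫ t in Ioi 0, maxExpDensity n t = 1 := by
  have h := sum_choose_laplace (f := fun _ => 1) (halfExpOrder_const 1) (fun k hk => by
    simp only [mul_one]
    rw [integral_exp_neg_mul_Ioi (by linarith)]
    exact mul_one_div_cancel (by linarith)) n
  simp only [mul_one] at h
  rw [sum_choose_Icc hn] at h
  linarith

theorem integrable_exp_neg_half_mul_abs : Integrable fun s : ℝ => Real.exp (-(1 / 2) * |s|) := by
  refine Integrable.of_integral_ne_zero ?_
  rw [integral_comp_abs (f := fun s => Real.exp (-(1 / 2) * s)), integral_exp_mul_Ioi (by norm_num)]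
  norm_num

/-- The maximum of `n` exponentials concentrates around `log n`. -/
theorem tendsto_integral_maxExpDensity {F N A : ℝ → ℝ} (hF : HalfExpOrder F) {C : ℝ}
    (hb : ∀ᶠ L in atTop, ∀ t > 0, |N L * (F t - A L)| ≤ C * Real.exp (|t - L| / 2))
    (hl : ∀ s, Tendsto (fun L => N L * (F (s + L) - A L)) atTop (𝓝 0)) :
    Tendsto (fun n : ℕ => N (Real.log n) *
      ((∫ t in Ioi 0, maxExpDensity n t * F t) - A (Real.log n))) atTop (𝓝 0) := by
  have hlog : Tendsto (fun n : ℕ => Real.log n) atTop atTop :=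
    Real.tendsto_log_atTop.comp tendsto_natCast_atTop_atTop
  let Φ : ℕ → ℝ → ℝ := fun n => (Ioi (0 : ℝ)).indicator fun t =>
    maxExpDensity n t * (N (Real.log n) * (F t - A (Real.log n)))
  -- After translation by `log n`, the density bound `8 e^{-|s|}` absorbs the allowed growth `C
  -- e^{|s|/2}`. The pointwise limit is 0 by `hl` and boundedness of the density, so the limiting
  -- Gumbel law is never needed.
  have key : Tendsto (fun n : ℕ => ∫ s, Φ n (s + Real.log n)) atTop (𝓝 (∫ _ : ℝ, (0 : ℝ))) := by
    refine tendsto_integral_filter_of_dominated_convergence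
      (fun s => 8 * C * Real.exp (-(1 / 2) * |s|)) ?_ ?_ ?_ ?_
    · refine Eventually.of_forall fun n => ?_
      have : AEStronglyMeasurable (Φ n) volume := by
        refine (aestronglyMeasurable_indicator_iff measurableSet_Ioi).2 ?_
        refine ContinuousOn.aestronglyMeasurable ?_ measurableSet_Ioi
        exact (continuous_maxExpDensity n).continuousOn.mul
          (continuousOn_const.mul (hF.cont.sub continuousOn_const))
      exact this.comp_measurePreserving (measurePreserving_add_right volume _)
    · filter_upwards [hlog.eventually hb, eventually_ge_atTop 2] with n hn hn2
      refine Eventually.of_forall fun s => ?_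
      by_cases hs : s + Real.log n ∈ Ioi (0 : ℝ)
      · simp only [Φ, indicator_of_mem hs]
        have h1 := hn _ hs
        have h2 := maxExpDensity_le hn2 (le_of_lt (show 0 < s + Real.log n from hs))
        rw [norm_mul, Real.norm_of_nonneg (maxExpDensity_nonneg n (le_of_lt hs)),
          Real.norm_eq_abs]
        rw [add_sub_cancel_right] at h1 h2
        calc _ ≤ 8 * Real.exp (-|s|) * (C * Real.exp (|s| / 2)) := by gcongr
          _ = 8 * C * (Real.exp (-|s|) * Real.exp (|s| / 2)) := by ring
          _ = _ := by rw [← Real.exp_add]; ring_nf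
      · simp only [Φ, indicator_of_notMem hs, norm_zero]
        have hC : 0 ≤ C := by
          have := (abs_nonneg _).trans (hn 1 one_pos)
          exact nonneg_of_mul_nonneg_left this (Real.exp_pos _)
        positivity
    · exact integrable_exp_neg_half_mul_abs.const_mul _
    · refine Eventually.of_forall fun s => ?_
      have h1 : Tendsto (fun n : ℕ => 8 * |N (Real.log n) * (F (s + Real.log n) - A (Real.log n))|)
          atTop (𝓝 0) := by
        simpa using (((hl s).comp hlog).abs.const_mul 8)
      refine squeeze_zero_norm' ?_ h1
      filter_upwards [eventually_ge_atTop 2] with n hn2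
      by_cases hs : s + Real.log n ∈ Ioi (0 : ℝ)
      · simp only [Φ, indicator_of_mem hs]
        rw [norm_mul, Real.norm_of_nonneg (maxExpDensity_nonneg n (le_of_lt hs)),
          Real.norm_eq_abs]
        gcongr
        refine (maxExpDensity_le hn2 (le_of_lt hs)).trans ?_
        have : Real.exp (-|s + Real.log n - Real.log n|) ≤ 1 := Real.exp_le_one_iff.2 (by simp)
        linarith
      · simp only [Φ, indicator_of_notMem hs, norm_zero]
        positivity
  simp only [integral_zero] at key
  refine key.congr' ?_
  filter_upwards [eventually_ge_atTop 1] with n hn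
  rw [integral_add_right_eq_self (Φ n), integral_indicator measurableSet_Ioi]
  have h1 := hF.integrableOn_maxExpDensity_mul n
  have h2 := (halfExpOrder_const (A (Real.log n))).integrableOn_maxExpDensity_mul n
  -- Total mass one lets the centring `A (log n)` move inside the integral.
  have h3 : ∫ t in Ioi 0, maxExpDensity n t * A (Real.log n) = A (Real.log n) := by
    rw [integral_mul_const, integral_maxExpDensity (by omega), one_mul]
  rw [← h3, ← integral_sub h1 h2, ← integral_const_mul]
  simp only [h3]
  exact integral_congr_ae (Eventually.of_forall fun t => by ring)

/-! ### The power `e^{-√k}` -/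

/-- The unnormalised error function. -/
noncomputable def gaussPrimitive (y : ℝ) : ℝ := ∫ x in (0 : ℝ)..y, Real.exp (-x ^ 2)

theorem hasDerivAt_gaussPrimitive (y : ℝ) :
    HasDerivAt gaussPrimitive (Real.exp (-y ^ 2)) y := by
  have hc : Continuous fun x : ℝ => Real.exp (-x ^ 2) := by fun_prop
  exact intervalIntegral.integral_hasDerivAt_right (hc.intervalIntegrable _ _)
    (hc.stronglyMeasurableAtFilter _ _) hc.continuousAt

theorem continuous_gaussPrimitive : Continuous gaussPrimitive :=
  continuous_iff_continuousAt.2 fun y => (hasDerivAt_gaussPrimitive y).continuousAt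

theorem gaussPrimitive_zero : gaussPrimitive 0 = 0 := by simp [gaussPrimitive]

theorem gaussPrimitive_neg (y : ℝ) : gaussPrimitive (-y) = -gaussPrimitive y := by
  have := intervalIntegral.integral_comp_neg (a := 0) (b := y) fun x : ℝ => Real.exp (-x ^ 2)
  simp only [neg_sq, neg_zero] at this
  rw [gaussPrimitive, gaussPrimitive, this, intervalIntegral.integral_symm]

theorem tendsto_gaussPrimitive_atTop :
    Tendsto gaussPrimitive atTop (𝓝 (Real.sqrt Real.pi / 2)) := by
  have h := integral_gaussian_Ioi 1
  have hi : IntegrableOn (fun x : ℝ => Real.exp (-x ^ 2)) (Ioi 0) := by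
    simpa using (integrable_exp_neg_mul_sq (b := 1) one_pos).integrableOn
  have := intervalIntegral_tendsto_integral_Ioi 0 hi tendsto_id
  simp only [neg_mul, one_mul, div_one] at h
  rw [h] at this
  exact this

theorem tendsto_gaussPrimitive_atBot :
    Tendsto gaussPrimitive atBot (𝓝 (-(Real.sqrt Real.pi / 2))) := by
  have := (tendsto_gaussPrimitive_atTop.comp tendsto_neg_atBot_atTop).neg
  refine this.congr fun y => ?_
  simp [gaussPrimitive_neg]

theorem gaussPrimitive_nonneg {y : ℝ} (hy : 0 ≤ y) : 0 ≤ gaussPrimitive y :=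
  intervalIntegral.integral_nonneg hy fun _ _ => (Real.exp_pos _).le

theorem gaussPrimitive_le_self {y : ℝ} (hy : 0 ≤ y) : gaussPrimitive y ≤ y := by
  have hc : Continuous fun x : ℝ => Real.exp (-x ^ 2) := by fun_prop
  have := intervalIntegral.integral_mono_on hy (hc.intervalIntegrable _ _)
    (intervalIntegrable_const (c := (1 : ℝ)) (μ := volume)) fun x _ =>
      Real.exp_le_one_iff.2 (by nlinarith [sq_nonneg x])
  simpa [gaussPrimitive] using this

theorem gaussPrimitive_le (y : ℝ) : gaussPrimitive y ≤ Real.sqrt Real.pi / 2 := by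
  have hm : Monotone gaussPrimitive := by
    refine monotone_of_deriv_nonneg (fun y => (hasDerivAt_gaussPrimitive y).differentiableAt)
      fun y => ?_
    rw [(hasDerivAt_gaussPrimitive y).deriv]
    exact (Real.exp_pos _).le
  exact hm.ge_of_tendsto tendsto_gaussPrimitive_atTop y

/-- The function `erf (1 / (2 √t))`, the tail of the Lévy distribution. -/
noncomputable def levyTail (t : ℝ) : ℝ :=
  2 / Real.sqrt Real.pi * gaussPrimitive (1 / (2 * Real.sqrt t))

theorem levyTail_nonneg (t : ℝ) : 0 ≤ levyTail t := by
  unfold levyTail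
  have := gaussPrimitive_nonneg (y := 1 / (2 * Real.sqrt t)) (by positivity)
  positivity

theorem levyTail_le_one (t : ℝ) : levyTail t ≤ 1 := by
  unfold levyTail
  have := gaussPrimitive_le (1 / (2 * Real.sqrt t))
  have hp : 0 < Real.sqrt Real.pi := Real.sqrt_pos.2 Real.pi_pos
  calc _ ≤ 2 / Real.sqrt Real.pi * (Real.sqrt Real.pi / 2) := by gcongr
    _ = 1 := by field_simp

theorem halfExpOrder_levyTail : HalfExpOrder levyTail where
  cont := by
    intro t ht
    have ht : 0 < t := ht
    have : ContinuousAt (fun t : ℝ => 1 / (2 * Real.sqrt t)) t :=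
      ContinuousAt.div continuousAt_const (by fun_prop) (by positivity)
    exact (continuousAt_const.mul
      (continuous_gaussPrimitive.continuousAt.comp this)).continuousWithinAt
  bound := ⟨1, fun t ht => by
    rw [abs_of_nonneg (levyTail_nonneg t), one_mul]
    exact (levyTail_le_one t).trans (Real.one_le_exp (by linarith))⟩

/-- An explicit antiderivative `H`: since `v w = √k/2` and `w² = kt`, completing the square gives
`e^{±√k} e^{-(v±w)²} = e^{-kt} e^{-v²}`. In the derivative the `w'` terms cancel and the `v'` terms
cancel against that of `levyTail`. The limits of `H` at `0+` and `∞` are `cosh √k - 1` and `sinh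
√k`. -/
theorem laplace_levyTail (k : ℝ) (hk : 1 ≤ k) :
    k * ∫ t in Ioi 0, Real.exp (-(k * t)) * levyTail t = 1 - Real.exp (-Real.sqrt k) := by
  have hk0 : 0 < k := by linarith
  have hp : 0 < Real.sqrt Real.pi := Real.sqrt_pos.2 Real.pi_pos
  have hsk : 0 < Real.sqrt k := Real.sqrt_pos.2 hk0
  let v : ℝ → ℝ := fun t => 1 / (2 * Real.sqrt t)
  let w : ℝ → ℝ := fun t => Real.sqrt k * Real.sqrt t
  let H : ℝ → ℝ := fun t => -(Real.exp (-(k * t)) * levyTail t) + 1 / Real.sqrt Real.pi *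
    (Real.exp (Real.sqrt k) * gaussPrimitive (v t + w t) +
      Real.exp (-Real.sqrt k) * gaussPrimitive (v t - w t))
  have hderiv : ∀ t ∈ Ioi (0 : ℝ),
      HasDerivAt H (k * (Real.exp (-(k * t)) * levyTail t)) t := by
    intro t ht
    have ht : 0 < t := ht
    have hst : 0 < Real.sqrt t := Real.sqrt_pos.2 ht
    have hs := Real.hasDerivAt_sqrt ht.ne'
    have hv' : DifferentiableAt ℝ v t :=
      (differentiableAt_const _).div (hs.differentiableAt.const_mul 2) (by positivity)
    have hv := hv'.hasDerivAt
    have hw := (hs.const_mul (Real.sqrt k))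
    set v' := deriv v t
    have hvw : v t * w t = Real.sqrt k / 2 := by simp only [v, w]; field_simp
    have hww : w t ^ 2 = k * t := by
      simp only [w, mul_pow, Real.sq_sqrt hk0.le, Real.sq_sqrt ht.le]
    have he : HasDerivAt (fun t => Real.exp (-(k * t))) (Real.exp (-(k * t)) * -k) t := by
      simpa using (((hasDerivAt_id t).const_mul k).neg).exp
    have hG : HasDerivAt levyTail (2 / Real.sqrt Real.pi * (Real.exp (-(v t) ^ 2) * v')) t :=
      ((hasDerivAt_gaussPrimitive (v t)).comp t hv).const_mul _
    have h1 := ((hasDerivAt_gaussPrimitive (v t + w t)).comp t (hv.add hw)).const_mul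
      (Real.exp (Real.sqrt k))
    have h2 := ((hasDerivAt_gaussPrimitive (v t - w t)).comp t (hv.sub hw)).const_mul
      (Real.exp (-Real.sqrt k))
    refine ((he.mul hG).neg.add ((h1.add h2).const_mul (1 / Real.sqrt Real.pi))).congr_deriv ?_
    have e1 : Real.exp (Real.sqrt k) * Real.exp (-(v t + w t) ^ 2) =
        Real.exp (-(k * t)) * Real.exp (-(v t) ^ 2) := by
      rw [← Real.exp_add, ← Real.exp_add]; congr 1; nlinarith
    have e2 : Real.exp (-Real.sqrt k) * Real.exp (-(v t - w t) ^ 2) =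
        Real.exp (-(k * t)) * Real.exp (-(v t) ^ 2) := by
      rw [← Real.exp_add, ← Real.exp_add]; congr 1; nlinarith
    simp only [← mul_assoc, e1, e2]
    field_simp
    ring
  have hS0 : Tendsto Real.sqrt (𝓝[>] 0) (𝓝[>] 0) := by
    refine tendsto_nhdsWithin_iff.2 ⟨?_, ?_⟩
    · simpa using (Real.continuous_sqrt.tendsto 0).mono_left nhdsWithin_le_nhds
    · filter_upwards [self_mem_nhdsWithin] with t ht
      exact Real.sqrt_pos.2 ht
  have hv0 : Tendsto v (𝓝[>] 0) atTop := by
    have := (tendsto_inv_nhdsGT_zero.comp hS0).const_mul_atTop (show (0 : ℝ) < 1 / 2 by norm_num)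
    refine this.congr fun t => ?_
    simp only [v, Function.comp]; ring
  have hw0 : Tendsto w (𝓝[>] 0) (𝓝 0) := by
    simpa using (hS0.mono_right nhdsWithin_le_nhds).const_mul (Real.sqrt k)
  have hS1 : Tendsto Real.sqrt atTop atTop := Real.tendsto_sqrt_atTop
  have hv1 : Tendsto v atTop (𝓝 0) := by
    have := (tendsto_inv_atTop_zero.comp hS1).const_mul (1 / 2 : ℝ)
    simp only [mul_zero] at this
    refine this.congr fun t => ?_
    simp only [v, Function.comp]; ring
  have hw1 : Tendsto w atTop atTop := hS1.const_mul_atTop hsk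
  have he0 : Tendsto (fun t => Real.exp (-(k * t))) (𝓝[>] 0) (𝓝 1) := by
    have : Continuous fun t => Real.exp (-(k * t)) := by fun_prop
    simpa using (this.tendsto 0).mono_left nhdsWithin_le_nhds
  have he1 : Tendsto (fun t => Real.exp (-(k * t))) atTop (𝓝 0) :=
    Real.tendsto_exp_neg_atTop_nhds_zero.comp (tendsto_id.const_mul_atTop hk0)
  have hG0 : Tendsto levyTail (𝓝[>] 0) (𝓝 1) := by
    have := (tendsto_gaussPrimitive_atTop.comp hv0).const_mul (2 / Real.sqrt Real.pi)
    rwa [show 2 / Real.sqrt Real.pi * (Real.sqrt Real.pi / 2) = 1 by field_simp] at this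
  have hG1 : Tendsto levyTail atTop (𝓝 0) := by
    have := ((continuous_gaussPrimitive.tendsto 0).comp hv1).const_mul (2 / Real.sqrt Real.pi)
    rwa [gaussPrimitive_zero, mul_zero] at this
  have hH0 : Tendsto H (𝓝[>] 0)
      (𝓝 (-(1 * 1) + 1 / Real.sqrt Real.pi * (Real.exp (Real.sqrt k) * (Real.sqrt Real.pi / 2) +
        Real.exp (-Real.sqrt k) * (Real.sqrt Real.pi / 2)))) := by
    refine (he0.mul hG0).neg.add (Tendsto.const_mul _ (Tendsto.add ?_ ?_))
    · exact (tendsto_gaussPrimitive_atTop.comp (hv0.atTop_add hw0)).const_mul _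
    · exact (tendsto_gaussPrimitive_atTop.comp
        (by simpa [sub_eq_add_neg] using hv0.atTop_add hw0.neg)).const_mul _
  have hH1 : Tendsto H atTop
      (𝓝 (-(0 * 0) + 1 / Real.sqrt Real.pi * (Real.exp (Real.sqrt k) * (Real.sqrt Real.pi / 2) +
        Real.exp (-Real.sqrt k) * -(Real.sqrt Real.pi / 2)))) := by
    refine (he1.mul hG1).neg.add (Tendsto.const_mul _ (Tendsto.add ?_ ?_))
    · exact (tendsto_gaussPrimitive_atTop.comp (hv1.add_atTop hw1)).const_mul _
    · refine (tendsto_gaussPrimitive_atBot.comp ?_).const_mul _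
      simpa [sub_eq_add_neg] using hv1.add_atBot (tendsto_neg_atTop_atBot.comp hw1)
  have hint := (halfExpOrder_levyTail.integrableOn hk).const_mul k
  -- Division by zero makes `v 0 = 0`, so `H` is discontinuous at 0. Integration by parts with `u =
  -- 1` is the fundamental theorem in a form needing only the one-sided limit there.
  have := integral_Ioi_deriv_mul_eq_sub (a := 0) (u := fun _ => (1 : ℝ)) (u' := fun _ => 0)
    (v := H) (v' := fun t => k * (Real.exp (-(k * t)) * levyTail t))
    (fun x _ => hasDerivAt_const x 1) hderiv (by simpa [IntegrableOn, Pi.mul_def, Pi.add_def] using hint)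
    (by simpa [Pi.mul_def] using hH0) (by simpa [Pi.mul_def] using hH1)
  simp only [zero_mul, one_mul, zero_add] at this
  rw [← integral_const_mul, this]
  field_simp
  ring

/-- Trades a normalisation in `L` for one in `t`, at an exponential cost in the distance: this is
how the dominating functions arise. -/
theorem le_one_add_mul_exp_abs_sub {L t : ℝ} (ht : 0 ≤ t) : L ≤ (1 + t) * Real.exp |t - L| := by
  have h1 := Real.add_one_le_exp |t - L|
  have h2 := neg_abs_le (t - L)
  have h3 := abs_nonneg (t - L)
  nlinarith

theorem tendsto_div_const_add_self (s : ℝ) : Tendsto (fun L : ℝ => L / (s + L)) atTop (𝓝 1) := by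
  have h : Tendsto (fun L : ℝ => 1 - s / (s + L)) atTop (𝓝 (1 - 0)) :=
    ((tendsto_atTop_add_const_left _ s tendsto_id).const_div_atTop s).const_sub 1
  rw [sub_zero] at h
  refine h.congr' ?_
  filter_upwards [eventually_gt_atTop (-s)] with L hL
  have : s + L ≠ 0 := by linarith
  field_simp
  ring

theorem isEquivalent_of_tendsto_inv_mul {u A : ℕ → ℝ} (hA : ∀ᶠ n in atTop, A n ≠ 0)
    (h : Tendsto (fun n => (A n)⁻¹ * (u n - A n)) atTop (𝓝 0)) : u ~[atTop] A := by
  refine (isLittleO_iff_tendsto' ?_).2 ?_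
  · filter_upwards [hA] with n hn h0 using absurd h0 hn
  · exact h.congr fun n => by simp [div_eq_inv_mul]

/-- The slope of `gaussPrimitive` at 0 is 1. -/
theorem tendsto_sqrt_mul_levyTail :
    Tendsto (fun t => Real.sqrt (Real.pi * t) * levyTail t) atTop (𝓝 1) := by
  have hv1 : Tendsto (fun t => 1 / (2 * Real.sqrt t)) atTop (𝓝[≠] 0) := by
    refine tendsto_nhdsWithin_iff.2 ⟨?_, ?_⟩
    · exact (Real.tendsto_sqrt_atTop.const_mul_atTop two_pos).const_div_atTop 1
    · filter_upwards [eventually_gt_atTop 0] with t ht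
      have := Real.sqrt_pos.2 ht
      exact ne_of_gt (by positivity)
  have h := (hasDerivAt_gaussPrimitive 0).tendsto_slope_zero.comp hv1
  simp only [zero_add, gaussPrimitive_zero, sub_zero, smul_eq_mul] at h
  norm_num at h
  refine h.congr' ?_
  filter_upwards [eventually_gt_atTop 0] with t ht
  have h1 := Real.sqrt_pos.2 ht
  have h2 := Real.sqrt_pos.2 Real.pi_pos
  simp only [Function.comp, levyTail, Real.sqrt_mul Real.pi_pos.le]
  rw [show (1 / (2 * Real.sqrt t)) = (Real.sqrt t)⁻¹ * (1 / 2) by field_simp]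
  field_simp

theorem sqrt_mul_levyTail_le {L t : ℝ} (hL : 0 ≤ L) (ht : 0 < t) :
    Real.sqrt (Real.pi * L) * levyTail t ≤ 3 * Real.exp (|t - L| / 2) := by
  have h1 := Real.sqrt_pos.2 ht
  have h2 := Real.sqrt_pos.2 Real.pi_pos
  have hG0 := levyTail_nonneg t
  have hG1 := levyTail_le_one t
  have hG2 : Real.sqrt (Real.pi * t) * levyTail t ≤ 1 := by
    have := gaussPrimitive_le_self (y := 1 / (2 * Real.sqrt t)) (by positivity)
    unfold levyTail
    calc _ ≤ Real.sqrt (Real.pi * t) * (2 / Real.sqrt Real.pi * (1 / (2 * Real.sqrt t))) := by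
          gcongr
      _ = 1 := by rw [Real.sqrt_mul Real.pi_pos.le]; field_simp
  have hG3 : Real.pi * t * levyTail t ^ 2 ≤ 1 := by
    have := pow_le_one₀ (n := 2) (by positivity) hG2
    rwa [mul_pow, Real.sq_sqrt (by have := Real.pi_pos; positivity)] at this
  have hG4 : levyTail t ^ 2 ≤ 1 := pow_le_one₀ hG0 hG1
  -- Squaring makes the left side linear in `L`; the resulting constant `π + 1` is below `3²`.
  refine (pow_le_pow_iff_left₀ (by positivity) (by positivity) two_ne_zero).1 ?_
  have he : Real.exp (|t - L| / 2) ^ 2 = Real.exp |t - L| := by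
    rw [← Real.exp_nat_mul]; congr 1; push_cast; ring
  rw [mul_pow, mul_pow, he, Real.sq_sqrt (by have := Real.pi_pos; positivity)]
  have h5 := le_one_add_mul_exp_abs_sub (L := L) ht.le
  calc Real.pi * L * levyTail t ^ 2
      ≤ Real.pi * ((1 + t) * Real.exp |t - L|) * levyTail t ^ 2 := by
        have := Real.pi_pos; gcongr
    _ = (Real.pi * levyTail t ^ 2 + Real.pi * t * levyTail t ^ 2) * Real.exp |t - L| := by ring
    _ ≤ 3 ^ 2 * Real.exp |t - L| := by
        gcongr
        nlinarith [Real.pi_lt_four, Real.pi_pos]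

theorem sum_choose_exp_neg_sqrt {n : ℕ} (hn : n ≠ 0) :
    ∑ k ∈ Finset.range (n + 1), (n.choose k : ℝ) * (-1 : ℝ) ^ k * Real.exp (-Real.sqrt (k : ℝ)) =
      ∫ t in Ioi 0, maxExpDensity n t * levyTail t := by
  have h1 := sum_choose_laplace (f := fun k => 1 - Real.exp (-Real.sqrt k))
    halfExpOrder_levyTail laplace_levyTail n
  simp only [mul_sub, mul_one, Finset.sum_sub_distrib, sum_choose_Icc hn] at h1
  rw [Finset.range_eq_Ico, Finset.sum_eq_sum_Ico_succ_bot (by omega),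
    show Finset.Ico (0 + 1) (n + 1) = Finset.Icc 1 n by ext; simp]
  simp
  linarith

theorem tendsto_log_natCast_atTop : Tendsto (fun n : ℕ => Real.log n) atTop atTop :=
  Real.tendsto_log_atTop.comp tendsto_natCast_atTop_atTop

theorem isEquivalent_sum_choose_exp_neg_sqrt :
    (fun n : ℕ => ∑ k ∈ Finset.range (n + 1),
          (n.choose k : ℝ) * (-1 : ℝ) ^ k * Real.exp (-Real.sqrt (k : ℝ)))
        ~[atTop] fun n : ℕ => 1 / Real.sqrt (Real.pi * Real.log (n : ℝ)) := by
  have hA : ∀ᶠ L in atTop, (0 : ℝ) < Real.sqrt (Real.pi * L) := by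
    filter_upwards [eventually_gt_atTop 0] with L hL
    exact Real.sqrt_pos.2 (mul_pos Real.pi_pos hL)
  have h := tendsto_integral_maxExpDensity (N := fun L => Real.sqrt (Real.pi * L))
    (A := fun L => 1 / Real.sqrt (Real.pi * L)) (C := 4) halfExpOrder_levyTail ?_ ?_
  · refine isEquivalent_of_tendsto_inv_mul ?_ (h.congr' ?_)
    · filter_upwards [tendsto_log_natCast_atTop.eventually hA] with n hn
      positivity
    · filter_upwards [eventually_ge_atTop 1] with n hn
      rw [sum_choose_exp_neg_sqrt (by omega), one_div, inv_inv]
  · filter_upwards [hA, eventually_ge_atTop 0] with L hL hL0 t ht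
    have h1 := sqrt_mul_levyTail_le hL0 ht
    have h2 := levyTail_nonneg t
    have h3 : (1 : ℝ) ≤ Real.exp (|t - L| / 2) := Real.one_le_exp (by positivity)
    have h4 : 0 ≤ Real.sqrt (Real.pi * L) * levyTail t := by positivity
    rw [mul_sub, mul_one_div_cancel hL.ne', abs_le]
    constructor <;> linarith
  · intro s
    have h1 := tendsto_sqrt_mul_levyTail.comp (tendsto_atTop_add_const_left atTop s tendsto_id)
    have h2 := (tendsto_div_const_add_self s).sqrt
    have h3 := (h2.mul h1).sub_const 1
    simp only [Real.sqrt_one, mul_one, sub_self] at h3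
    refine h3.congr' ?_
    filter_upwards [hA, eventually_gt_atTop (-s), eventually_gt_atTop 0] with L hL hLs hL0
    have h5 : 0 < s + L := by linarith
    have h6 := Real.sqrt_pos.2 h5
    simp only [Function.comp, id]
    rw [mul_sub, mul_one_div_cancel hL.ne', Real.sqrt_div hL0.le, Real.sqrt_mul Real.pi_pos.le,
      Real.sqrt_mul Real.pi_pos.le]
    field_simp

/-! ### The power `e^{√k}` -/

/-- Up to the sign `(-1)^n` this is the `n`-th forward difference at 0 of a polynomial of degree
below `n`. -/
theorem sum_choose_mul_pow_eq_zero {m n : ℕ} (h : m < n) :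
    ∑ k ∈ Finset.range (n + 1), (n.choose k : ℝ) * (-1) ^ k * (k : ℝ) ^ m = 0 := by
  have h1 := congrFun (fwdDiff_iter_pow_eq_zero_of_lt (R := ℝ) h) 0
  rw [fwdDiff_iter_eq_sum_shift] at h1
  have h2 : ∑ k ∈ Finset.range (n + 1), (n.choose k : ℝ) * (-1) ^ k * (k : ℝ) ^ m =
      (-1) ^ n * ∑ k ∈ Finset.range (n + 1),
        ((-1 : ℤ) ^ (n - k) * n.choose k) • ((0 : ℝ) + k • (1 : ℝ)) ^ m := by
    rw [Finset.mul_sum]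
    refine Finset.sum_congr rfl fun k hk => ?_
    have hk : k ≤ n := by simpa [Nat.lt_succ_iff] using hk
    have h3 : (-1 : ℝ) ^ k = (-1) ^ n * (-1) ^ (n - k) := by
      obtain ⟨j, rfl⟩ := Nat.exists_eq_add_of_le hk
      rw [Nat.add_sub_cancel_left, pow_add, mul_assoc, ← mul_pow]; simp
    rw [h3]
    simp
    ring
  rw [h2, h1]
  simp

/-- In `cosh √k = ∑ k^m/(2m)!` the terms with `m < n` are annihilated. For `m = n + j` the sum is at
most `2^n m^m/(2m)!`, and `n! j! m^m ≤ m! m^m ≤ (2m)!`; summing `1/j!` produces the factor `e`. -/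
theorem abs_sum_choose_cosh_sqrt_le (n : ℕ) :
    |∑ k ∈ Finset.range (n + 1), (n.choose k : ℝ) * (-1) ^ k * Real.cosh (Real.sqrt k)| ≤
      2 ^ n / n.factorial * Real.exp 1 := by
  have h1 : ∀ k : ℕ, HasSum (fun m : ℕ => (k : ℝ) ^ m / (2 * m).factorial)
      (Real.cosh (Real.sqrt k)) := by
    intro k
    refine (Real.hasSum_cosh (Real.sqrt k)).congr_fun ?_
    intro m
    rw [pow_mul, Real.sq_sqrt (Nat.cast_nonneg k)]
  have h2 := hasSum_sum fun k (_ : k ∈ Finset.range (n + 1)) =>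
    (h1 k).mul_left ((n.choose k : ℝ) * (-1) ^ k)
  have h3 := (hasSum_nat_add_iff' n).2 h2
  have h4 : ∀ m, ∑ k ∈ Finset.range (n + 1),
      (n.choose k : ℝ) * (-1) ^ k * ((k : ℝ) ^ m / (2 * m).factorial) =
      (∑ k ∈ Finset.range (n + 1), (n.choose k : ℝ) * (-1) ^ k * (k : ℝ) ^ m) /
        ((2 * m).factorial : ℝ) := by
    intro m
    rw [Finset.sum_div]
    exact Finset.sum_congr rfl fun k _ => by ring
  simp only [h4] at h3
  rw [Finset.sum_eq_zero (s := Finset.range n) (fun m hm => by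
    rw [sum_choose_mul_pow_eq_zero (Finset.mem_range.1 hm), zero_div]), sub_zero] at h3
  have h5 : HasSum (fun j : ℕ => 2 ^ n / (n.factorial : ℝ) * (1 / (j.factorial : ℝ)))
      (2 ^ n / n.factorial * Real.exp 1) := by
    refine HasSum.mul_left _ ?_
    simpa [Real.exp_eq_exp_ℝ] using NormedSpace.expSeries_div_hasSum_exp (1 : ℝ)
  refine h3.norm_le_of_bounded h5 fun j => ?_
  set m := j + n
  have hb : |∑ k ∈ Finset.range (n + 1), (n.choose k : ℝ) * (-1) ^ k * (k : ℝ) ^ m| ≤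
      2 ^ n * (m : ℝ) ^ m := by
    refine (Finset.abs_sum_le_sum_abs _ _).trans ?_
    have : (2 : ℝ) ^ n = ∑ k ∈ Finset.range (n + 1), (n.choose k : ℝ) := by
      exact_mod_cast (Nat.sum_range_choose n).symm
    rw [this, Finset.sum_mul]
    refine Finset.sum_le_sum fun k hk => ?_
    have hk : k ≤ n := by simpa [Nat.lt_succ_iff] using hk
    have hkm : (k : ℝ) ≤ m := by exact_mod_cast hk.trans (Nat.le_add_left n j)
    rw [abs_mul, abs_mul, abs_pow, abs_neg, abs_one, one_pow, mul_one, Nat.abs_cast,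
      abs_of_nonneg (by positivity)]
    gcongr
  have hf : (n.factorial : ℝ) * j.factorial * (m : ℝ) ^ m ≤ (2 * m).factorial := by
    have e1 : n.factorial * j.factorial ≤ m.factorial := by
      rw [mul_comm]
      exact Nat.le_of_dvd (Nat.factorial_pos _) (Nat.factorial_mul_factorial_dvd_factorial_add j n)
    have e2 : m.factorial * m ^ m ≤ (2 * m).factorial := by
      refine le_trans ?_ ((Nat.factorial_mul_pow_le_factorial (m := m) (n := m)).trans
        (le_of_eq (by rw [two_mul])))
      gcongr; omega
    exact_mod_cast (Nat.mul_le_mul_right _ e1).trans e2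
  rw [Real.norm_eq_abs, abs_div, Nat.abs_cast, div_mul_div_comm, mul_one]
  rw [div_le_div_iff₀ (by positivity) (by positivity)]
  calc _ ≤ 2 ^ n * (m : ℝ) ^ m * (n.factorial * j.factorial) := by gcongr
    _ = 2 ^ n * ((n.factorial : ℝ) * j.factorial * (m : ℝ) ^ m) := by ring
    _ ≤ _ := by gcongr

theorem isEquivalent_sum_choose_exp_sqrt :
    (fun n : ℕ => ∑ k ∈ Finset.range (n + 1),
          (n.choose k : ℝ) * (-1 : ℝ) ^ k * Real.exp (Real.sqrt (k : ℝ)))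
        ~[atTop] fun n : ℕ => -1 / Real.sqrt (Real.pi * Real.log (n : ℝ)) := by
  have h1 := isEquivalent_sum_choose_exp_neg_sqrt.neg
  have h2 : (fun n : ℕ => ∑ k ∈ Finset.range (n + 1), (n.choose k : ℝ) * (-1) ^ k *
      Real.cosh (Real.sqrt k) * 2) =o[atTop]
      fun n : ℕ => -(1 / Real.sqrt (Real.pi * Real.log (n : ℝ))) := by
    have hA : ∀ᶠ L in atTop, (0 : ℝ) < Real.sqrt (Real.pi * L) := by
      filter_upwards [eventually_gt_atTop 0] with L hL
      exact Real.sqrt_pos.2 (mul_pos Real.pi_pos hL)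
    refine (isLittleO_iff_tendsto' ?_).2 ?_
    · filter_upwards [tendsto_log_natCast_atTop.eventually hA] with n hn h0
      rw [neg_eq_zero] at h0
      exact absurd h0 (by positivity)
    · have h3 := (FloorSemiring.tendsto_pow_div_factorial_atTop (4 : ℝ)).mul_const
        (8 * Real.exp 1)
      rw [zero_mul] at h3
      refine squeeze_zero_norm' ?_ h3
      filter_upwards [eventually_ge_atTop 1] with n hn
      have hn1 : (1 : ℝ) ≤ n := by exact_mod_cast hn
      -- A crude bound is enough: the ratio becomes a multiple of `4^n/n!`.
      have hs : Real.sqrt (Real.pi * Real.log n) ≤ 4 * 2 ^ n := by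
        have e1 : Real.log n ≤ n := (Real.log_le_sub_one_of_pos (by positivity)).trans (by linarith)
        have e2 : (n : ℝ) ≤ 2 ^ n := by exact_mod_cast Nat.lt_two_pow_self.le
        refine Real.sqrt_le_iff.2 ⟨by positivity, ?_⟩
        have e3 : (1 : ℝ) ≤ 2 ^ n := one_le_pow₀ one_le_two
        calc Real.pi * Real.log n ≤ 4 * 2 ^ n :=
              mul_le_mul Real.pi_le_four (e1.trans e2) (Real.log_nonneg hn1) (by norm_num)
          _ ≤ _ := by nlinarith
      rw [← Finset.sum_mul, norm_div, norm_neg, norm_mul, Real.norm_eq_abs]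
      rw [Real.norm_of_nonneg (by positivity : (0 : ℝ) ≤ 1 / Real.sqrt _), div_div_eq_mul_div,
        div_one, Real.norm_of_nonneg zero_le_two]
      calc _ ≤ 2 ^ n / n.factorial * Real.exp 1 * 2 * (4 * 2 ^ n) := by
            gcongr; exact abs_sum_choose_cosh_sqrt_le n
        _ = _ := by
            rw [show (4 : ℝ) ^ n = 2 ^ n * 2 ^ n by rw [← mul_pow]; norm_num]; ring
  have h3 := h1.add_isLittleO h2
  refine (h3.congr_left ?_).congr_right ?_
  · refine Eventually.of_forall fun n => ?_
    simp only [Pi.add_apply, ← Finset.sum_neg_distrib, ← Finset.sum_add_distrib]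
    refine Finset.sum_congr rfl fun k _ => ?_
    rw [Real.cosh_eq]; ring
  · exact Eventually.of_forall fun n => by simp [neg_div]

/-! ### Asymptotics of the Bessel integrals -/

/-- Laplace's method at the left end point of an interval, for complex phases. -/
theorem tendsto_sqrt_mul_integral_exp_mul {g h : ℝ → ℂ} {b c α : ℝ} (hb : 0 < b) (hc : 0 < c)
    (hg : Continuous g) (hh : Continuous h)
    (hre : ∀ θ ∈ Icc 0 b, (g θ).re ≤ -(c * θ ^ 2))
    (hlim : Tendsto (fun θ : ℝ => g θ / (θ : ℂ) ^ 2) (𝓝[>] 0) (𝓝 (-(α : ℂ)))) :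
    Tendsto (fun x : ℝ => (Real.sqrt x : ℂ) * ∫ θ in (0 : ℝ)..b, Complex.exp (x * g θ) * h θ) atTop
      (𝓝 (h 0 * (Real.sqrt (Real.pi / α) / 2 : ℝ))) := by
  obtain ⟨M, hM⟩ := (isCompact_Icc (a := 0) (b := b)).exists_bound_of_continuousOn hh.continuousOn
  have hM0 : 0 ≤ M := (norm_nonneg _).trans (hM 0 (left_mem_Icc.2 hb.le))
  -- Rescaling `θ = φ/√x`: `hre` supplies the Gaussian majorant `M e^{-cφ²}`, and `hlim` the
  -- pointwise limit `h(0) e^{-αφ²}`.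
  let Φ : ℝ → ℝ → ℂ := fun x => (Ioc 0 (b * Real.sqrt x)).indicator fun φ =>
    Complex.exp (x * g (φ / Real.sqrt x)) * h (φ / Real.sqrt x)
  have hval : ∫ φ, (Ioi (0 : ℝ)).indicator (fun φ : ℝ => h 0 * (Real.exp (-α * φ ^ 2) : ℂ)) φ =
      h 0 * (Real.sqrt (Real.pi / α) / 2 : ℝ) := by
    rw [integral_indicator measurableSet_Ioi, integral_const_mul, ← integral_gaussian_Ioi]
    exact congrArg _ integral_ofReal
  have key : Tendsto (fun x => ∫ φ, Φ x φ) atTop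
      (𝓝 (∫ φ, (Ioi (0 : ℝ)).indicator (fun φ : ℝ => h 0 * (Real.exp (-α * φ ^ 2) : ℂ)) φ)) := by
    refine tendsto_integral_filter_of_dominated_convergence
      (fun φ => M * Real.exp (-c * φ ^ 2)) ?_ ?_ ?_ ?_
    · refine Eventually.of_forall fun x => ?_
      refine (Continuous.aestronglyMeasurable ?_).indicator measurableSet_Ioc
      fun_prop
    · filter_upwards [eventually_gt_atTop 0] with x hx
      have hsx := Real.sqrt_pos.2 hx
      refine Eventually.of_forall fun φ => ?_
      by_cases hφ : φ ∈ Ioc 0 (b * Real.sqrt x)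
      · have hmem : φ / Real.sqrt x ∈ Icc 0 b :=
          ⟨div_nonneg hφ.1.le hsx.le, (div_le_iff₀ hsx).2 hφ.2⟩
        simp only [Φ, indicator_of_mem hφ]
        rw [norm_mul, Complex.norm_exp, Complex.re_ofReal_mul, mul_comm]
        have h1 := mul_le_mul_of_nonneg_left (hre _ hmem) hx.le
        rw [div_pow, Real.sq_sqrt hx.le] at h1
        have h2 : x * -(c * (φ ^ 2 / x)) = -c * φ ^ 2 := by field_simp
        rw [h2] at h1
        exact mul_le_mul (hM _ hmem) (Real.exp_le_exp.2 h1) (Real.exp_pos _).le hM0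
      · simp only [Φ, indicator_of_notMem hφ, norm_zero]
        positivity
    · exact (integrable_exp_neg_mul_sq hc).const_mul M
    · refine Eventually.of_forall fun φ => ?_
      by_cases hφ : 0 < φ
      · have ht0 : Tendsto (fun x => φ / Real.sqrt x) atTop (𝓝 0) :=
          Real.tendsto_sqrt_atTop.const_div_atTop φ
        have ht : Tendsto (fun x => φ / Real.sqrt x) atTop (𝓝[>] 0) := by
          refine tendsto_nhdsWithin_iff.2 ⟨ht0, ?_⟩
          filter_upwards [eventually_gt_atTop 0] with x hx
          exact div_pos hφ (Real.sqrt_pos.2 hx)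
        have h1 := ((hlim.comp ht).const_mul ((φ : ℂ) ^ 2)).cexp
        have h2 := h1.mul ((hh.tendsto 0).comp ht0)
        have h3 : Complex.exp ((φ : ℂ) ^ 2 * -(α : ℂ)) * h 0 =
            (Ioi (0 : ℝ)).indicator (fun φ : ℝ => h 0 * (Real.exp (-α * φ ^ 2) : ℂ)) φ := by
          rw [indicator_of_mem (show φ ∈ Ioi (0 : ℝ) from hφ)]
          push_cast; ring_nf
        rw [h3] at h2
        refine h2.congr' ?_
        filter_upwards [eventually_gt_atTop 0,
          (Real.tendsto_sqrt_atTop.const_mul_atTop hb).eventually_ge_atTop φ] with x hx hxφ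
        have hmem : φ ∈ Ioc 0 (b * Real.sqrt x) := ⟨hφ, hxφ⟩
        have hsx := Real.sqrt_pos.2 hx
        simp only [Φ, indicator_of_mem hmem, Function.comp]
        congr 2
        have e1 : ((φ / Real.sqrt x : ℝ) : ℂ) ^ 2 = (φ : ℂ) ^ 2 / x := by
          rw [← Complex.ofReal_pow, div_pow, Real.sq_sqrt hx.le]; push_cast; rfl
        have hx' : (x : ℂ) ≠ 0 := by exact_mod_cast hx.ne'
        have hφ' : (φ : ℂ) ≠ 0 := by exact_mod_cast hφ.ne'
        rw [e1]
        field_simp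
      · have h1 : ∀ x, Φ x φ = 0 := fun x => indicator_of_notMem (fun h => hφ h.1) _
        simp only [h1]
        rw [indicator_of_notMem (show φ ∉ Ioi (0 : ℝ) from hφ)]
        exact tendsto_const_nhds
  rw [hval] at key
  refine key.congr' ?_
  filter_upwards [eventually_gt_atTop 0] with x hx
  have hsx := Real.sqrt_pos.2 hx
  rw [integral_indicator measurableSet_Ioc, ← intervalIntegral.integral_of_le (by positivity),
    intervalIntegral.integral_comp_div (fun θ => Complex.exp (x * g θ) * h θ) hsx.ne', zero_div,
    mul_div_cancel_right₀ _ hsx.ne']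
  simp

/-- The modified Bessel function `I₀`. -/
noncomputable def besselI (x : ℝ) : ℝ :=
  1 / Real.pi * ∫ θ in (0 : ℝ)..Real.pi, Real.cosh (x * Real.cos θ)

/-- The Bessel function `J₀`. -/
noncomputable def besselJ (x : ℝ) : ℝ :=
  1 / Real.pi * ∫ θ in (0 : ℝ)..Real.pi, Real.cos (x * Real.cos θ)

theorem continuous_besselI : Continuous besselI :=
  continuous_const.mul
    (intervalIntegral.continuous_parametric_intervalIntegral_of_continuous' (by fun_prop) _ _)

theorem continuous_besselJ : Continuous besselJ :=
  continuous_const.mul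
    (intervalIntegral.continuous_parametric_intervalIntegral_of_continuous' (by fun_prop) _ _)

/-- The reflection `θ ↦ π - θ` replaces `cosh` by an exponential whose phase, for `x > 0`, peaks
only at the left end point. -/
theorem besselI_eq_integral_exp (x : ℝ) :
    besselI x = 1 / Real.pi * ∫ θ in (0 : ℝ)..Real.pi, Real.exp (x * Real.cos θ) := by
  have h := intervalIntegral.integral_comp_sub_left (a := 0) (b := Real.pi)
    (fun θ => Real.exp (x * Real.cos θ)) Real.pi
  simp only [Real.cos_pi_sub, sub_self, sub_zero, mul_neg] at h
  simp only [besselI, Real.cosh_eq]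
  rw [intervalIntegral.integral_div, intervalIntegral.integral_add, h]
  · ring
  all_goals exact Continuous.intervalIntegrable (by fun_prop) _ _

theorem tendsto_cos_sub_one_div_sq :
    Tendsto (fun z : ℂ => (Complex.cos z - 1) / z ^ 2) (𝓝[≠] 0) (𝓝 (-(1 / 2))) := by
  have h1 : Tendsto (fun z : ℂ => Complex.sin (z / 2) / (z / 2)) (𝓝[≠] 0) (𝓝 1) := by
    have h := (Complex.hasDerivAt_sin 0).tendsto_slope_zero
    simp only [zero_add, Complex.sin_zero, sub_zero, smul_eq_mul, Complex.cos_zero] at h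
    have h2 : Tendsto (fun z : ℂ => z / 2) (𝓝[≠] 0) (𝓝[≠] 0) := by
      refine tendsto_nhdsWithin_iff.2 ⟨?_, ?_⟩
      · have : Continuous fun z : ℂ => z / 2 := by fun_prop
        simpa using (this.tendsto 0).mono_left nhdsWithin_le_nhds
      · filter_upwards [self_mem_nhdsWithin] with z hz
        simpa using hz
    exact (h.comp h2).congr fun z => by simp [div_eq_inv_mul]
  have h2 := (h1.pow 2).const_mul (-(1 / 2) : ℂ)
  rw [one_pow, mul_one] at h2
  refine h2.congr' ?_
  filter_upwards [self_mem_nhdsWithin] with z hz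
  have hz : z ≠ 0 := hz
  have h3 : Complex.cos z = 1 - 2 * Complex.sin (z / 2) ^ 2 := by
    have := Complex.cos_two_mul' (z / 2)
    rw [show 2 * (z / 2) = z by ring] at this
    rw [this, Complex.cos_sq']
    ring
  rw [h3]
  field_simp
  ring

theorem tendsto_besselI :
    Tendsto (fun x => Real.sqrt x * Real.exp (-x) * besselI x) atTop
      (𝓝 (1 / Real.sqrt (2 * Real.pi))) := by
  have hπ := Real.pi_pos
  -- `c` comes from `cos θ ≤ 1 - 2θ²/π²` on `[0, π]`, and `α` from the Taylor expansion at 0.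
  have h := tendsto_sqrt_mul_integral_exp_mul (g := fun θ : ℝ => ((Real.cos θ - 1 : ℝ) : ℂ))
    (h := fun _ => 1) (b := Real.pi) (c := 2 / Real.pi ^ 2) (α := 1 / 2) hπ (by positivity)
    (by fun_prop) continuous_const ?_ ?_
  · have h1 := (Complex.continuous_re.tendsto _).comp h
    have h2 := h1.const_mul (1 / Real.pi)
    have h3 : 1 / Real.pi * ((1 : ℂ) * (Real.sqrt (Real.pi / (1 / 2)) / 2 : ℝ)).re =
        1 / Real.sqrt (2 * Real.pi) := by
      rw [one_mul, Complex.ofReal_re, show Real.pi / (1 / 2) = 2 * Real.pi by ring]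
      have hs : 0 < Real.sqrt (2 * Real.pi) := Real.sqrt_pos.2 (by positivity)
      rw [div_mul_div_comm, one_mul, div_eq_div_iff (by positivity) hs.ne', ← sq,
        Real.sq_sqrt (by positivity)]
      ring
    rw [h3] at h2
    refine h2.congr fun x => ?_
    have h4 : ∀ θ : ℝ, Complex.exp (x * ((Real.cos θ - 1 : ℝ) : ℂ)) * 1 =
        ((Real.exp (-x) * Real.exp (x * Real.cos θ) : ℝ) : ℂ) := by
      intro θ
      rw [← Real.exp_add, mul_one]
      push_cast; ring_nf
    simp only [Function.comp, h4]
    rw [intervalIntegral.integral_ofReal, ← Complex.ofReal_mul, Complex.ofReal_re,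
      intervalIntegral.integral_const_mul, besselI_eq_integral_exp]
    ring
  · intro θ hθ
    rw [Complex.ofReal_re]
    have := Real.cos_le_one_sub_mul_cos_sq (x := θ) (by rw [abs_of_nonneg hθ.1]; exact hθ.2)
    linarith
  · have h1 : Tendsto (fun θ : ℝ => (θ : ℂ)) (𝓝[>] 0) (𝓝[≠] 0) := by
      refine tendsto_nhdsWithin_iff.2 ⟨?_, ?_⟩
      · simpa using (Complex.continuous_ofReal.tendsto 0).mono_left nhdsWithin_le_nhds
      · filter_upwards [self_mem_nhdsWithin] with θ hθ
        exact Complex.ofReal_ne_zero.2 (ne_of_gt hθ)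
    have h2 := tendsto_cos_sub_one_div_sq.comp h1
    have h3 : (-((1 / 2 : ℝ) : ℂ)) = -(1 / 2) := by push_cast; ring
    rw [h3]
    exact h2.congr fun θ => by simp

/-! ### Steepest descent for `J₀`. -/

/-- A path of steepest descent type joining the critical points `0` and `π` of the cosine. -/
noncomputable def cosPath (θ : ℝ) : ℂ := θ - Real.sin θ * Complex.I

theorem hasDerivAt_cosPath (θ : ℝ) : HasDerivAt cosPath (1 - Real.cos θ * Complex.I) θ :=
  (hasDerivAt_id θ).ofReal_comp.sub ((Real.hasDerivAt_sin θ).ofReal_comp.mul_const _)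

theorem continuous_cosPath : Continuous cosPath := by
  unfold cosPath; fun_prop

/-- On the real axis the integrand has modulus one and Laplace's method does not apply. It is
entire, hence has a primitive, and the path has the same end points 0 and `π`. -/
theorem integral_exp_cos_eq_cosPath (x : ℝ) :
    ∫ θ in (0 : ℝ)..Real.pi, Complex.exp (Complex.I * x * Real.cos θ) =
      ∫ θ in (0 : ℝ)..Real.pi, Complex.exp (Complex.I * x * Complex.cos (cosPath θ)) *
        (1 - Real.cos θ * Complex.I) := by
  obtain ⟨P, hP⟩ := (show Differentiable ℂ fun z : ℂ =>
    Complex.exp (Complex.I * x * Complex.cos z) by fun_prop).isExactOn_univ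
  have hP : ∀ z : ℂ, HasDerivAt P (Complex.exp (Complex.I * x * Complex.cos z)) z :=
    fun z => hP z (mem_univ z)
  have hcc := continuous_cosPath
  rw [intervalIntegral.integral_eq_sub_of_hasDerivAt
      (f := fun θ : ℝ => P (cosPath θ)) (fun θ _ => (hP _).comp θ (hasDerivAt_cosPath θ))
      (Continuous.intervalIntegrable (by fun_prop) _ _),
    intervalIntegral.integral_eq_sub_of_hasDerivAt
      (f := fun θ : ℝ => P θ) (fun θ _ => ?_)
      (Continuous.intervalIntegrable (by fun_prop) _ _)]
  · simp [cosPath]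
  · simpa using (hP θ).comp_ofReal

theorem cosPath_pi_sub (θ : ℝ) :
    cosPath (Real.pi - θ) = Real.pi - (starRingEnd ℂ) (cosPath θ) := by
  simp only [cosPath, Real.sin_pi_sub, map_sub, map_mul, Complex.conj_ofReal, Complex.conj_I]
  push_cast; ring

/-- Under `θ ↦ π - θ` the integrand is conjugated, so the critical point `π` contributes the
conjugate of what 0 does and only half the path remains. -/
theorem besselJ_eq_cosPath (x : ℝ) :
    besselJ x = 2 / Real.pi * (∫ θ in (0 : ℝ)..Real.pi / 2,
      Complex.exp (Complex.I * x * Complex.cos (cosPath θ)) *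
        (1 - Real.cos θ * Complex.I)).re := by
  set q : ℝ → ℂ := fun θ => Complex.exp (Complex.I * x * Complex.cos (cosPath θ)) *
        (1 - Real.cos θ * Complex.I) with hq
  have hcc := continuous_cosPath
  have hqc : Continuous q := by fun_prop
  have hre : ∀ {f : ℝ → ℂ} (_ : Continuous f) (a b : ℝ),
      (∫ θ in a..b, f θ).re = ∫ θ in a..b, (f θ).re := fun hf a b =>
    (Complex.reCLM.intervalIntegral_comp_comm (hf.intervalIntegrable a b)).symm
  have hsymm : ∀ θ, (q (Real.pi - θ)).re = (q θ).re := by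
    intro θ
    have : q (Real.pi - θ) = (starRingEnd ℂ) (q θ) := by
      simp only [hq, cosPath_pi_sub, Complex.cos_pi_sub, Real.cos_pi_sub, map_mul,
        ← Complex.exp_conj, map_sub, map_one, Complex.conj_ofReal, Complex.conj_I,
        ← Complex.cos_conj]
      push_cast; ring_nf
    rw [this, Complex.conj_re]
  have h1 : ∫ θ in (0 : ℝ)..Real.pi, Real.cos (x * Real.cos θ) =
      ∫ θ in (0 : ℝ)..Real.pi, (q θ).re := by
    rw [← hre hqc, hq, ← integral_exp_cos_eq_cosPath, hre (by fun_prop)]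
    refine intervalIntegral.integral_congr fun θ _ => ?_
    have : Complex.I * x * Real.cos θ = ((x * Real.cos θ : ℝ) : ℂ) * Complex.I := by
      push_cast; ring
    simp only [this, Complex.exp_ofReal_mul_I_re]
  have hrc : Continuous fun θ => (q θ).re := Complex.continuous_re.comp hqc
  have h2 : ∫ θ in (Real.pi / 2)..Real.pi, (q θ).re = ∫ θ in (0 : ℝ)..Real.pi / 2, (q θ).re := by
    have := intervalIntegral.integral_comp_sub_left (a := 0) (b := Real.pi / 2)
      (fun θ => (q θ).re) Real.pi
    simp only [hsymm, sub_zero] at this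
    rw [this]; congr 1; ring
  rw [besselJ, h1, ← intervalIntegral.integral_add_adjacent_intervals
    (hrc.intervalIntegrable 0 (Real.pi / 2)) (hrc.intervalIntegrable _ _), h2, hre hqc]
  ring

theorem re_I_mul_cos_cosPath (θ : ℝ) :
    (Complex.I * (Complex.cos (cosPath θ) - 1)).re = -(Real.sin θ * Real.sinh (Real.sin θ)) := by
  have h : Complex.cos (cosPath θ) = ((Real.cos θ * Real.cosh (Real.sin θ) : ℝ) : ℂ) +
      ((Real.sin θ * Real.sinh (Real.sin θ) : ℝ) : ℂ) * Complex.I := by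
    rw [cosPath, Complex.cos_sub, Complex.cos_mul_I, Complex.sin_mul_I]
    push_cast; ring
  rw [h]
  simp [Complex.mul_re, -Complex.ofReal_mul, -Complex.ofReal_cos, -Complex.ofReal_sin,
    -Complex.ofReal_cosh, -Complex.ofReal_sinh]

/-- The path leaves 0 in the direction `1 - i`, and `i · (-1/2) · (1 - i)² = -1`: the phase is real
and negative to second order. -/
theorem tendsto_cosPath_phase :
    Tendsto (fun θ : ℝ => Complex.I * (Complex.cos (cosPath θ) - 1) / (θ : ℂ) ^ 2) (𝓝[>] 0)
      (𝓝 (-((1 : ℝ) : ℂ))) := by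
  have h0 : cosPath 0 = 0 := by simp [cosPath]
  have hne : ∀ θ : ℝ, θ ≠ 0 → cosPath θ ≠ 0 := by
    intro θ hθ h
    have := congrArg Complex.re h
    simp [cosPath, -Complex.ofReal_sin] at this
    exact hθ this
  have h1 : Tendsto cosPath (𝓝[>] 0) (𝓝[≠] 0) := by
    refine tendsto_nhdsWithin_iff.2 ⟨?_, ?_⟩
    · have := (continuous_cosPath.tendsto 0).mono_left (nhdsWithin_le_nhds (s := Ioi 0))
      rwa [h0] at this
    · filter_upwards [self_mem_nhdsWithin] with θ hθ
      exact hne θ (ne_of_gt hθ)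
  have h2 : Tendsto (fun θ : ℝ => cosPath θ / θ) (𝓝[>] 0) (𝓝 (1 - Complex.I)) := by
    have := (hasDerivAt_cosPath 0).tendsto_slope_zero_right
    simp only [zero_add, h0, sub_zero, Real.cos_zero, Complex.ofReal_one, one_mul] at this
    refine this.congr fun θ => ?_
    rw [Complex.real_smul]; push_cast; ring
  have h3 := ((tendsto_cos_sub_one_div_sq.comp h1).mul (h2.pow 2)).const_mul Complex.I
  have h4 : Complex.I * (-(1 / 2) * (1 - Complex.I) ^ 2) = -((1 : ℝ) : ℂ) := by
    push_cast
    linear_combination (1 - Complex.I / 2) * Complex.I_sq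
  rw [h4] at h3
  refine h3.congr' ?_
  filter_upwards [self_mem_nhdsWithin] with θ hθ
  have h5 : (θ : ℂ) ≠ 0 := Complex.ofReal_ne_zero.2 (ne_of_gt hθ)
  have h6 := hne θ (ne_of_gt hθ)
  simp only [Function.comp]
  field_simp

theorem tendsto_besselJ :
    Tendsto (fun x => Real.sqrt x * besselJ x - (Real.cos x + Real.sin x) / Real.sqrt Real.pi)
      atTop (𝓝 0) := by
  have hπ := Real.pi_pos
  have hcc := continuous_cosPath
  -- `c = (2/π)²` comes from Jordan's inequality `sin θ ≥ 2θ/π` together with `sinh s ≥ s`.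
  have h := tendsto_sqrt_mul_integral_exp_mul
    (g := fun θ : ℝ => Complex.I * (Complex.cos (cosPath θ) - 1))
    (h := fun θ => 1 - Real.cos θ * Complex.I) (b := Real.pi / 2) (c := (2 / Real.pi) ^ 2)
    (α := 1) (by positivity) (by positivity) (by fun_prop) (by fun_prop) ?_ tendsto_cosPath_phase
  · have hs := Real.sqrt_pos.2 hπ
    rw [Real.cos_zero, div_one, Complex.ofReal_one, one_mul] at h
    set Z : ℝ → ℂ := fun x => (Real.sqrt x : ℂ) * ∫ θ in (0 : ℝ)..Real.pi / 2,
      Complex.exp (x * (Complex.I * (Complex.cos (cosPath θ) - 1))) *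
        (1 - Real.cos θ * Complex.I) with hZ
    set Z0 : ℂ := (1 - Complex.I) * (Real.sqrt Real.pi / 2 : ℝ) with hZ0
    have h1 := (tendsto_iff_norm_sub_tendsto_zero.1 h).const_mul (2 / Real.pi)
    rw [mul_zero] at h1
    refine squeeze_zero_norm (fun x => ?_) h1
    -- Only `Z` converges; the unimodular factor `e^{ix}` keeps oscillating, so the two sides are
    -- compared through `‖Z x - Z0‖`.
    have e1 : Real.sqrt x * besselJ x =
        2 / Real.pi * (Complex.exp (x * Complex.I) * Z x).re := by
      rw [besselJ_eq_cosPath]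
      have : Complex.exp (x * Complex.I) * Z x = ((Real.sqrt x : ℝ) : ℂ) *
          ∫ θ in (0 : ℝ)..Real.pi / 2, Complex.exp (Complex.I * x * Complex.cos (cosPath θ)) *
        (1 - Real.cos θ * Complex.I) := by
        rw [hZ]
        simp only []
        rw [mul_left_comm, ← intervalIntegral.integral_const_mul]
        congr 1
        refine intervalIntegral.integral_congr fun θ _ => ?_
        rw [← mul_assoc, ← Complex.exp_add]
        congr 2
        ring
      rw [this, Complex.re_ofReal_mul]
      ring
    have e2 : (Real.cos x + Real.sin x) / Real.sqrt Real.pi =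
        2 / Real.pi * (Complex.exp (x * Complex.I) * Z0).re := by
      have : Complex.exp (x * Complex.I) * Z0 = ((Real.sqrt Real.pi / 2 : ℝ) : ℂ) *
          (Complex.exp (x * Complex.I) * (1 - Complex.I)) := by rw [hZ0]; ring
      rw [this, Complex.re_ofReal_mul, Complex.mul_re, Complex.exp_ofReal_mul_I_re,
        Complex.exp_ofReal_mul_I_im]
      have h2 := Real.mul_self_sqrt hπ.le
      simp only [Complex.sub_re, Complex.one_re, Complex.I_re, Complex.sub_im, Complex.one_im,
        Complex.I_im]
      rw [div_eq_iff hs.ne']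
      field_simp
      rw [Real.sq_sqrt hπ.le]
      ring
    rw [e1, e2, ← mul_sub, ← Complex.sub_re, ← mul_sub, norm_mul,
      Real.norm_of_nonneg (by positivity)]
    gcongr
    refine (Complex.abs_re_le_norm _).trans ?_
    rw [norm_mul, Complex.norm_exp_ofReal_mul_I, one_mul]
  · intro θ hθ
    rw [re_I_mul_cos_cosPath, neg_le_neg_iff]
    have h1 := Real.mul_le_sin hθ.1 hθ.2
    have h0 : 0 ≤ 2 / Real.pi * θ := mul_nonneg (by positivity) hθ.1
    have h2 := Real.self_le_sinh_iff.2 (h0.trans h1)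
    nlinarith [mul_le_mul h1 (h1.trans h2) h0 (h0.trans h1)]

/-! ### Power series and Laplace transforms of the Bessel integrals -/

theorem integral_cos_pow_even (n : ℕ) :
    ∫ θ in (0 : ℝ)..Real.pi, Real.cos θ ^ (2 * n) =
      Real.pi * (2 * n).factorial / (4 ^ n * (n.factorial : ℝ) ^ 2) := by
  induction n with
  | zero => simp
  | succ n ih =>
    rw [show 2 * (n + 1) = 2 * n + 2 by ring, integral_cos_pow, ih, Real.sin_pi, Real.sin_zero,
      Nat.factorial_succ, Nat.factorial_succ, Nat.factorial_succ]
    push_cast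
    have : (n.factorial : ℝ) ≠ 0 := by positivity
    have : (n : ℝ) + 1 ≠ 0 := by positivity
    field_simp
    ring

/-- Termwise integration, dominated by the series of `cosh x`; the Wallis integrals cancel `(2j)!`.
The sign `σ` covers `I₀` and `J₀` at once. -/
theorem hasSum_integral_comp_mul_cos {σ : ℝ} (hσ : |σ| = 1) {ψ : ℝ → ℝ}
    (hψ : ∀ y, HasSum (fun j : ℕ => σ ^ j * y ^ (2 * j) / (2 * j).factorial) (ψ y)) (x : ℝ) :
    HasSum (fun j : ℕ => σ ^ j * (x / 2) ^ (2 * j) / (j.factorial : ℝ) ^ 2)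
      (1 / Real.pi * ∫ θ in (0 : ℝ)..Real.pi, ψ (x * Real.cos θ)) := by
  have h := intervalIntegral.hasSum_integral_of_dominated_convergence
    (F := fun (j : ℕ) θ => σ ^ j * (x * Real.cos θ) ^ (2 * j) / (2 * j).factorial)
    (f := fun θ => ψ (x * Real.cos θ)) (a := 0) (b := Real.pi) (μ := volume)
    (fun j _ => x ^ (2 * j) / (2 * j).factorial) ?_ ?_ ?_ ?_ ?_
  · refine (h.mul_left (1 / Real.pi)).congr_fun fun j => ?_
    have e : ∀ θ, σ ^ j * (x * Real.cos θ) ^ (2 * j) / ((2 * j).factorial : ℝ) =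
        σ ^ j * x ^ (2 * j) / (2 * j).factorial * Real.cos θ ^ (2 * j) := fun θ => by ring
    simp only [e]
    rw [intervalIntegral.integral_const_mul, integral_cos_pow_even, div_pow, pow_mul 2]
    have := Real.pi_pos
    field_simp
    norm_num
  · exact fun j => (by fun_prop : Continuous fun θ : ℝ =>
      σ ^ j * (x * Real.cos θ) ^ (2 * j) / ((2 * j).factorial : ℝ)).aestronglyMeasurable
  · refine fun j => Eventually.of_forall fun θ _ => ?_
    rw [norm_div, norm_mul, norm_pow, Real.norm_eq_abs, hσ, one_pow, one_mul,
      Real.norm_of_nonneg (Nat.cast_nonneg _), Real.norm_of_nonneg ((even_two_mul j).pow_nonneg _),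
      mul_pow]
    gcongr
    refine mul_le_of_le_one_right ((even_two_mul j).pow_nonneg _) ?_
    rw [pow_mul]
    exact pow_le_one₀ (sq_nonneg _) (Real.cos_sq_le_one θ)
  · exact Eventually.of_forall fun θ _ => (Real.hasSum_cosh x).summable
  · exact intervalIntegrable_const
  · exact Eventually.of_forall fun θ _ => hψ _

theorem integral_pow_mul_exp_neg_mul {k : ℝ} (hk : 0 < k) (j : ℕ) :
    ∫ t in Ioi (0 : ℝ), t ^ j * Real.exp (-(k * t)) = (1 / k) ^ (j + 1) * j.factorial := by
  have h := Real.integral_rpow_mul_exp_neg_mul_Ioi (a := j + 1) (by positivity) hk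
  rw [Real.Gamma_nat_eq_factorial] at h
  simp only [add_sub_cancel_right, Real.rpow_natCast] at h
  rw [h]
  norm_cast

theorem integrableOn_pow_mul_exp_neg_mul {k : ℝ} (hk : 0 < k) (j : ℕ) :
    IntegrableOn (fun t : ℝ => t ^ j * Real.exp (-(k * t))) (Ioi 0) := by
  refine Integrable.of_integral_ne_zero ?_
  rw [integral_pow_mul_exp_neg_mul hk]
  positivity

/-- `∫ t^j e^{-kt} dt = j!/k^{j+1}` cancels one of the two factorials, leaving the exponential
series; absolute summability justifies the exchange. -/
theorem laplace_of_hasSum {σ : ℝ} (hσ : |σ| = 1) {F : ℝ → ℝ}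
    (hF : ∀ t > 0, HasSum (fun j : ℕ => σ ^ j * t ^ j / (j.factorial : ℝ) ^ 2) (F t))
    (k : ℝ) (hk : 1 ≤ k) :
    k * ∫ t in Ioi 0, Real.exp (-(k * t)) * F t = Real.exp (σ * (1 / k)) := by
  have hk0 : 0 < k := by linarith
  let f : ℕ → ℝ → ℝ := fun j t =>
    σ ^ j / (j.factorial : ℝ) ^ 2 * (t ^ j * Real.exp (-(k * t)))
  have hs : ∀ a : ℝ, HasSum (fun j : ℕ => a ^ j / j.factorial) (Real.exp a) := fun a => by
    simpa [Real.exp_eq_exp_ℝ] using NormedSpace.expSeries_div_hasSum_exp a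
  have hint : ∀ j, ∫ t in Ioi 0, f j t = 1 / k * ((σ * (1 / k)) ^ j / j.factorial) := by
    intro j
    simp only [f]
    rw [integral_const_mul, integral_pow_mul_exp_neg_mul hk0, mul_pow,
      pow_succ (1 / k)]
    field_simp
  have hnorm : ∀ j, ∫ t in Ioi 0, ‖f j t‖ = 1 / k * ((1 / k) ^ j / j.factorial) := by
    intro j
    have : ∫ t in Ioi 0, ‖f j t‖ =
        ∫ t in Ioi 0, 1 / (j.factorial : ℝ) ^ 2 * (t ^ j * Real.exp (-(k * t))) := by
      refine setIntegral_congr_fun measurableSet_Ioi fun t ht => ?_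
      have ht : 0 < t := ht
      simp only [f]
      rw [norm_mul, norm_div, norm_pow, Real.norm_eq_abs, hσ, one_pow,
        Real.norm_of_nonneg (by positivity), Real.norm_of_nonneg (by positivity)]
    rw [this, integral_const_mul, integral_pow_mul_exp_neg_mul hk0, pow_succ (1 / k)]
    field_simp
  have h := hasSum_integral_of_summable_integral_norm (F := f) (μ := volume.restrict (Ioi 0))
    (fun j => (integrableOn_pow_mul_exp_neg_mul hk0 j).const_mul _)
    (by simp only [hnorm]; exact ((hs _).mul_left _).summable)
  simp only [hint] at h
  have h2 := h.unique ((hs (σ * (1 / k))).mul_left (1 / k))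
  have h3 : ∫ t in Ioi 0, Real.exp (-(k * t)) * F t = ∫ t in Ioi 0, ∑' j, f j t := by
    refine setIntegral_congr_fun measurableSet_Ioi fun t ht => ?_
    rw [← ((hF t ht).mul_left (Real.exp (-(k * t)))).tsum_eq]
    exact tsum_congr fun j => by simp only [f]; ring
  rw [h3, h2]
  field_simp

theorem hasSum_besselI_two_mul_sqrt {t : ℝ} (ht : 0 ≤ t) :
    HasSum (fun j : ℕ => (1 : ℝ) ^ j * t ^ j / (j.factorial : ℝ) ^ 2)
      (besselI (2 * Real.sqrt t)) := by
  have h := hasSum_integral_comp_mul_cos (σ := 1) abs_one (ψ := Real.cosh)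
    (fun y => by simpa using Real.hasSum_cosh y) (2 * Real.sqrt t)
  simpa only [mul_div_cancel_left₀ _ (two_ne_zero (α := ℝ)), pow_mul, Real.sq_sqrt ht, besselI] using h

theorem hasSum_besselJ_two_mul_sqrt {t : ℝ} (ht : 0 ≤ t) :
    HasSum (fun j : ℕ => (-1 : ℝ) ^ j * t ^ j / (j.factorial : ℝ) ^ 2)
      (besselJ (2 * Real.sqrt t)) := by
  have h := hasSum_integral_comp_mul_cos (σ := -1) (by simp) (ψ := Real.cos)
    (fun y => Real.hasSum_cos y) (2 * Real.sqrt t)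
  simpa only [mul_div_cancel_left₀ _ (two_ne_zero (α := ℝ)), pow_mul, Real.sq_sqrt ht, besselJ] using h

/-- Puts `I₀(2√t)` within exponential order `1/2`. -/
theorem two_mul_sqrt_le {t : ℝ} (ht : 0 ≤ t) : 2 * Real.sqrt t ≤ t / 2 + 2 := by
  nlinarith [Real.sq_sqrt ht, sq_nonneg (Real.sqrt t - 2)]

theorem halfExpOrder_besselI : HalfExpOrder fun t => besselI (2 * Real.sqrt t) where
  cont := (continuous_besselI.comp (by fun_prop)).continuousOn
  bound := ⟨Real.exp 2, fun t ht => by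
    have hπ := Real.pi_pos
    rw [besselI_eq_integral_exp, abs_mul, abs_of_nonneg (by positivity)]
    have := intervalIntegral.norm_integral_le_of_norm_le_const (a := 0) (b := Real.pi)
      (f := fun θ => Real.exp (2 * Real.sqrt t * Real.cos θ)) (C := Real.exp 2 * Real.exp (t / 2))
      fun θ _ => by
        rw [Real.norm_eq_abs, Real.abs_exp, ← Real.exp_add]
        refine Real.exp_le_exp.2 ?_
        have h1 := two_mul_sqrt_le ht.le
        have h2 := mul_le_of_le_one_right (by positivity : 0 ≤ 2 * Real.sqrt t) (Real.cos_le_one θ)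
        linarith
    rw [sub_zero, abs_of_pos hπ, Real.norm_eq_abs] at this
    rw [one_div, inv_mul_le_iff₀ hπ]
    linarith⟩

theorem abs_besselJ_le_one (x : ℝ) : |besselJ x| ≤ 1 := by
  have hπ := Real.pi_pos
  rw [besselJ, abs_mul, abs_of_nonneg (by positivity)]
  have := intervalIntegral.norm_integral_le_of_norm_le_const (a := 0) (b := Real.pi)
    (f := fun θ => Real.cos (x * Real.cos θ)) (C := 1) fun θ _ => Real.abs_cos_le_one _
  rw [sub_zero, abs_of_pos hπ, Real.norm_eq_abs] at this
  rw [one_div, inv_mul_le_iff₀ hπ]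
  linarith

theorem halfExpOrder_besselJ : HalfExpOrder fun t => besselJ (2 * Real.sqrt t) where
  cont := (continuous_besselJ.comp (by fun_prop)).continuousOn
  bound := ⟨1, fun t ht => by
    rw [one_mul]
    exact (abs_besselJ_le_one _).trans (Real.one_le_exp (by linarith))⟩

/-! ### The powers `e^{1/k}` and `e^{-1/k}` -/

theorem rpow_quarter_eq_sqrt_sqrt {t : ℝ} (ht : 0 ≤ t) :
    t ^ (1 / 4 : ℝ) = Real.sqrt (Real.sqrt t) := by
  rw [Real.sqrt_eq_rpow, Real.sqrt_eq_rpow, ← Real.rpow_mul ht]; norm_num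

theorem tendsto_sqrt_const_add_sub_sqrt (s : ℝ) :
    Tendsto (fun L => Real.sqrt (s + L) - Real.sqrt L) atTop (𝓝 0) := by
  have h1 : Tendsto (fun L => Real.sqrt (s + L) + Real.sqrt L) atTop atTop :=
    (Real.tendsto_sqrt_atTop.comp (tendsto_atTop_add_const_left atTop s tendsto_id)).atTop_add_atTop
      Real.tendsto_sqrt_atTop
  refine (h1.const_div_atTop s).congr' ?_
  filter_upwards [eventually_gt_atTop 0, eventually_gt_atTop (-s)] with L h0 hs
  have h2 := Real.sqrt_pos.2 h0
  have h3 : 0 < s + L := by linarith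
  have h4 := Real.sqrt_pos.2 h3
  rw [div_eq_iff (by positivity)]
  nlinarith [Real.sq_sqrt h0.le, Real.sq_sqrt h3.le]

theorem tendsto_sqrt_sqrt_div (s : ℝ) :
    Tendsto (fun L => Real.sqrt (Real.sqrt (L / (s + L)))) atTop (𝓝 1) := by
  simpa using (tendsto_div_const_add_self s).sqrt.sqrt

/-- Compactness for small `t` and the hypothesis for large `t` bound `(1+t)^{1/4} G(t)`; the fourth
root of `le_one_add_mul_exp_abs_sub` then passes to `L`. The exponent `1/4` leaves room for a second
such factor in the `I₀` case. -/
theorem sqrt_sqrt_mul_le_of_eventually_le {G : ℝ → ℝ} (hG : Continuous G) {c : ℝ}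
    (h : ∀ᶠ t in atTop, |Real.sqrt (Real.sqrt t) * G t| ≤ c) :
    ∃ C, ∀ t ≥ 0, ∀ L ≥ 0, Real.sqrt (Real.sqrt L) * |G t| ≤ C * Real.exp (|t - L| / 4) := by
  obtain ⟨T, hT⟩ := eventually_atTop.1 h
  obtain ⟨M, hM⟩ := (isCompact_Icc (a := (0 : ℝ)) (b := max T 1)).exists_bound_of_continuousOn
    (f := fun t => Real.sqrt (Real.sqrt (1 + t)) * G t) (by fun_prop)
  refine ⟨max M (2 * c), fun t ht L hL => ?_⟩
  have h1 : Real.sqrt (Real.sqrt (1 + t)) * |G t| ≤ max M (2 * c) := by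
    rcases le_total t (max T 1) with h2 | h2
    · have := hM t ⟨ht, h2⟩
      rw [norm_mul, Real.norm_of_nonneg (Real.sqrt_nonneg _), Real.norm_eq_abs] at this
      exact this.trans (le_max_left _ _)
    · have h3 := hT t ((le_max_left _ _).trans h2)
      have h4 : 1 ≤ t := (le_max_right _ _).trans h2
      rw [abs_mul, abs_of_nonneg (Real.sqrt_nonneg _)] at h3
      have h5 : Real.sqrt (Real.sqrt (1 + t)) ≤ 2 * Real.sqrt (Real.sqrt t) := by
        have e1 : Real.sqrt (1 + t) ≤ 2 ^ 2 * Real.sqrt t := by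
          rw [Real.sqrt_le_left (by positivity), mul_pow, Real.sq_sqrt ht]
          linarith
        rw [Real.sqrt_le_left (by positivity), mul_pow, Real.sq_sqrt (Real.sqrt_nonneg _)]
        exact e1
      refine le_trans ?_ (le_max_right _ _)
      calc _ ≤ 2 * Real.sqrt (Real.sqrt t) * |G t| := by gcongr
        _ ≤ _ := by linarith
  have h6 : Real.sqrt (Real.sqrt L) ≤ Real.sqrt (Real.sqrt (1 + t)) * Real.exp (|t - L| / 4) := by
    have e1 : Real.exp |t - L| = (Real.exp (|t - L| / 4) ^ 2) ^ 2 := by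
      rw [← pow_mul, ← Real.exp_nat_mul]; congr 1; push_cast; ring
    have e2 := le_one_add_mul_exp_abs_sub (L := L) ht
    rw [e1] at e2
    have e3 := Real.sqrt_le_sqrt (Real.sqrt_le_sqrt e2)
    rwa [Real.sqrt_mul (by positivity), Real.sqrt_sq (by positivity),
      Real.sqrt_mul (by positivity), Real.sqrt_sq (by positivity)] at e3
  calc _ ≤ Real.sqrt (Real.sqrt (1 + t)) * Real.exp (|t - L| / 4) * |G t| := by gcongr
    _ = Real.sqrt (Real.sqrt (1 + t)) * |G t| * Real.exp (|t - L| / 4) := by ring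
    _ ≤ _ := by gcongr

theorem sqrt_two_mul_sqrt (t : ℝ) :
    Real.sqrt (2 * Real.sqrt t) = Real.sqrt 2 * Real.sqrt (Real.sqrt t) :=
  Real.sqrt_mul zero_le_two _

theorem tendsto_two_mul_sqrt_atTop : Tendsto (fun t => 2 * Real.sqrt t) atTop atTop :=
  Real.tendsto_sqrt_atTop.const_mul_atTop two_pos

theorem tendsto_besselI_two_mul_sqrt :
    Tendsto (fun t => Real.sqrt (Real.sqrt t) * (Real.exp (-(2 * Real.sqrt t)) *
      besselI (2 * Real.sqrt t))) atTop (𝓝 (1 / (2 * Real.sqrt Real.pi))) := by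
  have h := (tendsto_besselI.comp tendsto_two_mul_sqrt_atTop).const_mul (1 / Real.sqrt 2)
  have h2 := Real.mul_self_sqrt (zero_le_two (α := ℝ))
  have h0 : 0 < Real.sqrt 2 := Real.sqrt_pos.2 two_pos
  have e : 1 / Real.sqrt 2 * (1 / Real.sqrt (2 * Real.pi)) = 1 / (2 * Real.sqrt Real.pi) := by
    rw [Real.sqrt_mul zero_le_two, div_mul_div_comm, one_mul, ← mul_assoc, h2]
  rw [e] at h
  refine h.congr fun t => ?_
  simp only [Function.comp, sqrt_two_mul_sqrt]
  field_simp

theorem isEquivalent_integral_besselI :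
    (fun n : ℕ => ∫ t in Ioi 0, maxExpDensity n t * besselI (2 * Real.sqrt t)) ~[atTop]
      fun n : ℕ => Real.exp (2 * Real.sqrt (Real.log n)) /
        (2 * Real.sqrt Real.pi * Real.sqrt (Real.sqrt (Real.log n))) := by
  have hsπ := Real.sqrt_pos.2 Real.pi_pos
  let A : ℝ → ℝ := fun L => Real.exp (2 * Real.sqrt L) /
    (2 * Real.sqrt Real.pi * Real.sqrt (Real.sqrt L))
  have hA : ∀ L, 0 < L → 0 < A L := fun L hL => by
    have := Real.sqrt_pos.2 (Real.sqrt_pos.2 hL)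
    simp only [A]; positivity
  -- Splits the normalised function into a part with a finite limit and the growth ratio `e^{2√t -
  -- 2√L}`.
  have hNF : ∀ L t, (A L)⁻¹ * besselI (2 * Real.sqrt t) =
      2 * Real.sqrt Real.pi * (Real.sqrt (Real.sqrt L) * (Real.exp (-(2 * Real.sqrt t)) *
        besselI (2 * Real.sqrt t))) * Real.exp (2 * Real.sqrt t - 2 * Real.sqrt L) := by
    intro L t
    rw [Real.exp_neg, Real.exp_sub, inv_div]
    field_simp
  have hcont : Continuous fun t => Real.exp (-(2 * Real.sqrt t)) * besselI (2 * Real.sqrt t) :=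
    (by fun_prop : Continuous fun t => Real.exp (-(2 * Real.sqrt t))).mul
      (continuous_besselI.comp (by fun_prop))
  obtain ⟨C, hC⟩ := sqrt_sqrt_mul_le_of_eventually_le hcont
    (tendsto_besselI_two_mul_sqrt.abs.eventually_le_const (lt_add_one _))
  have h := tendsto_integral_maxExpDensity (N := fun L => (A L)⁻¹) (A := A)
    (C := 2 * Real.sqrt Real.pi * C + 1) halfExpOrder_besselI ?_ ?_
  · refine isEquivalent_of_tendsto_inv_mul ?_ h
    filter_upwards [tendsto_log_natCast_atTop.eventually_gt_atTop 0] with n hn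
    exact (hA _ hn).ne'
  -- `L ≥ 64` gives `√t + √L ≥ 8`, hence `2(√t - √L) ≤ |t - L|/4`.
  · filter_upwards [eventually_ge_atTop 64] with L hL t ht
    have hL0 : 0 < L := by linarith
    rw [mul_sub, inv_mul_cancel₀ (hA L hL0).ne', hNF]
    refine (abs_sub _ _).trans ?_
    have h1 := hC t ht.le L hL0.le
    have h2 : 2 * Real.sqrt t - 2 * Real.sqrt L ≤ |t - L| / 4 := by
      have e1 : 8 ≤ Real.sqrt L := Real.le_sqrt_of_sq_le (by linarith)
      have e2 := le_abs_self (t - L)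
      have e3 := Real.sq_sqrt hL0.le
      have e4 := Real.sq_sqrt ht.le
      have e5 := Real.sqrt_nonneg t
      by_cases hlt : Real.sqrt t ≤ Real.sqrt L
      · linarith [abs_nonneg (t - L)]
      · nlinarith
    have h3 : (1 : ℝ) ≤ Real.exp (|t - L| / 2) := Real.one_le_exp (by positivity)
    rw [abs_one, abs_mul, abs_mul, Real.abs_exp, abs_of_pos (by positivity : 0 < 2 * Real.sqrt Real.pi),
      abs_mul (Real.sqrt (Real.sqrt L)), abs_of_nonneg (Real.sqrt_nonneg (Real.sqrt L)), add_mul, one_mul]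
    refine add_le_add ?_ h3
    calc _ ≤ 2 * Real.sqrt Real.pi * (C * Real.exp (|t - L| / 4)) * Real.exp (|t - L| / 4) := by
          have h4 : (0 : ℝ) ≤ Real.sqrt (Real.sqrt L) *
            |Real.exp (-(2 * Real.sqrt t)) * besselI (2 * Real.sqrt t)| := by positivity
          exact mul_le_mul (mul_le_mul_of_nonneg_left h1 (by positivity)) (Real.exp_le_exp.2 h2)
            (Real.exp_pos _).le (mul_nonneg (by positivity) (h4.trans h1))
      _ = 2 * Real.sqrt Real.pi * C * (Real.exp (|t - L| / 4) * Real.exp (|t - L| / 4)) := by ring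
      _ = _ := by rw [← Real.exp_add]; ring_nf
  · intro s
    have h1 := tendsto_besselI_two_mul_sqrt.comp (tendsto_atTop_add_const_left atTop s tendsto_id)
    have h2 := ((tendsto_sqrt_const_add_sub_sqrt s).const_mul 2).rexp
    have h3 := ((((tendsto_sqrt_sqrt_div s).mul h1).const_mul (2 * Real.sqrt Real.pi)).mul
      h2).sub_const 1
    have e : 2 * Real.sqrt Real.pi * (1 * (1 / (2 * Real.sqrt Real.pi))) * Real.exp (2 * 0) - 1 =
        0 := by
      rw [mul_zero, Real.exp_zero]; field_simp; norm_num
    rw [e] at h3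
    refine h3.congr' ?_
    filter_upwards [eventually_gt_atTop (-s), eventually_gt_atTop 0] with L hLs hL0
    have h5 : 0 < s + L := by linarith
    have h6 := Real.sqrt_pos.2 (Real.sqrt_pos.2 h5)
    rw [mul_sub (A L)⁻¹, inv_mul_cancel₀ (hA L hL0).ne', hNF]
    simp only [Function.comp, id]
    rw [Real.sqrt_div hL0.le, Real.sqrt_div (Real.sqrt_nonneg L), mul_sub 2]
    congr 3
    field_simp

theorem tendsto_besselJ_two_mul_sqrt :
    Tendsto (fun t => Real.sqrt (Real.sqrt t) * besselJ (2 * Real.sqrt t) -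
      Real.cos (2 * Real.sqrt t - Real.pi / 4) / Real.sqrt Real.pi) atTop (𝓝 0) := by
  have h := (tendsto_besselJ.comp tendsto_two_mul_sqrt_atTop).const_mul (Real.sqrt 2 / 2)
  rw [mul_zero] at h
  refine h.congr fun t => ?_
  have h2 := Real.mul_self_sqrt (zero_le_two (α := ℝ))
  simp only [Function.comp, sqrt_two_mul_sqrt]
  rw [Real.cos_sub, Real.cos_pi_div_four, Real.sin_pi_div_four]
  linear_combination (Real.sqrt (Real.sqrt t) * besselJ (2 * Real.sqrt t) / 2) * h2

/-- The cosine has zeros for arbitrarily large arguments, so the error is stated additively rather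
than as an equivalence. -/
theorem tendsto_integral_besselJ :
    Tendsto (fun n : ℕ => Real.sqrt (Real.sqrt (Real.log n)) *
      ((∫ t in Ioi 0, maxExpDensity n t * besselJ (2 * Real.sqrt t)) -
        Real.cos (2 * Real.sqrt (Real.log n) - Real.pi / 4) /
          (Real.sqrt Real.pi * Real.sqrt (Real.sqrt (Real.log n))))) atTop (𝓝 0) := by
  have hsπ := Real.sqrt_pos.2 Real.pi_pos
  let m : ℝ → ℝ := fun L => Real.cos (2 * Real.sqrt L - Real.pi / 4) / Real.sqrt Real.pi
  have hm : ∀ L, |m L| ≤ 1 := by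
    intro L
    have h1 : 1 ≤ Real.sqrt Real.pi := Real.one_le_sqrt.2 (by linarith [Real.pi_gt_three])
    simp only [m]
    rw [abs_div, abs_of_pos hsπ]
    exact div_le_one_of_le₀ ((Real.abs_cos_le_one _).trans h1) hsπ.le
  have hmA : ∀ L, 0 < L → Real.sqrt (Real.sqrt L) *
      (Real.cos (2 * Real.sqrt L - Real.pi / 4) /
        (Real.sqrt Real.pi * Real.sqrt (Real.sqrt L))) = m L := fun L hL => by
    have := Real.sqrt_pos.2 (Real.sqrt_pos.2 hL)
    simp only [m]; field_simp
  have hcont : Continuous fun t => besselJ (2 * Real.sqrt t) :=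
    continuous_besselJ.comp (by fun_prop)
  obtain ⟨C, hC⟩ := sqrt_sqrt_mul_le_of_eventually_le hcont (c := 2) (by
    have h := tendsto_besselJ_two_mul_sqrt.abs.eventually_le_const
      (show |(0 : ℝ)| < 1 by norm_num)
    filter_upwards [h] with t ht
    have := abs_add_le (Real.sqrt (Real.sqrt t) * besselJ (2 * Real.sqrt t) - m t) (m t)
    rw [sub_add_cancel] at this
    have ht : |Real.sqrt (Real.sqrt t) * besselJ (2 * Real.sqrt t) - m t| ≤ 1 := ht
    linarith [hm t])
  refine tendsto_integral_maxExpDensity (N := fun L => Real.sqrt (Real.sqrt L))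
    (A := fun L => Real.cos (2 * Real.sqrt L - Real.pi / 4) /
        (Real.sqrt Real.pi * Real.sqrt (Real.sqrt L)))
    (C := C + 1) halfExpOrder_besselJ ?_ ?_
  · filter_upwards [eventually_gt_atTop 0] with L hL0 t ht
    rw [mul_sub, hmA L hL0]
    refine (abs_sub _ _).trans ?_
    have h1 := hC t ht.le L hL0.le
    have hC0 : 0 ≤ C := by
      have := (by positivity : (0 : ℝ) ≤ Real.sqrt (Real.sqrt L) * |besselJ (2 * Real.sqrt t)|).trans h1
      exact nonneg_of_mul_nonneg_left this (Real.exp_pos _)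
    have h2 : Real.exp (|t - L| / 4) ≤ Real.exp (|t - L| / 2) :=
      Real.exp_le_exp.2 (by linarith [abs_nonneg (t - L)])
    have h3 : (1 : ℝ) ≤ Real.exp (|t - L| / 2) := Real.one_le_exp (by positivity)
    rw [abs_mul, abs_of_nonneg (Real.sqrt_nonneg _), add_mul, one_mul]
    exact add_le_add (h1.trans (by gcongr)) ((hm L).trans h3)
  · intro s
    have h1 := tendsto_besselJ_two_mul_sqrt.comp (tendsto_atTop_add_const_left atTop s tendsto_id)
    have hq := tendsto_sqrt_sqrt_div s
    have h2 : Tendsto (fun L => (Real.sqrt (Real.sqrt (L / (s + L))) - 1) * m (s + L)) atTop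
        (𝓝 0) := by
      have h3 := (hq.sub_const 1).abs
      rw [sub_self, abs_zero] at h3
      refine squeeze_zero_norm (fun L => ?_) h3
      rw [norm_mul]
      exact mul_le_of_le_one_right (norm_nonneg _) (hm _)
    have h3 : Tendsto (fun L => m (s + L) - m L) atTop (𝓝 0) := by
      have h4 := (((tendsto_sqrt_const_add_sub_sqrt s).const_mul 2).abs).div_const
        (Real.sqrt Real.pi)
      rw [mul_zero, abs_zero, zero_div] at h4
      refine squeeze_zero_norm (fun L => ?_) h4
      simp only [m]
      rw [← sub_div, norm_div, Real.norm_eq_abs, Real.norm_of_nonneg hsπ.le]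
      refine div_le_div_of_nonneg_right ?_ hsπ.le
      refine (Real.abs_cos_sub_cos_le _ _).trans (le_of_eq ?_)
      congr 1; ring
    -- Three errors: the asymptotics of `J₀` at `s + L`, the change of normalisation, and the shift
    -- of the cosine, which is Lipschitz while `√(s+L) - √L → 0`.
    have h4 := ((hq.mul h1).add h2).add h3
    simp only [mul_zero, add_zero] at h4
    refine h4.congr' ?_
    filter_upwards [eventually_gt_atTop (-s), eventually_gt_atTop 0] with L hLs hL0
    have h5 : 0 < s + L := by linarith
    have h6 := Real.sqrt_pos.2 (Real.sqrt_pos.2 h5)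
    rw [mul_sub, hmA L hL0]
    simp only [Function.comp, id]
    rw [Real.sqrt_div hL0.le, Real.sqrt_div (Real.sqrt_nonneg L)]
    change _ * (_ - m (s + L)) + _ + _ = _
    field_simp
    ring

theorem mainTheorem8 :
    ((fun n : ℕ => ∑ k ∈ Finset.range (n + 1),
          (n.choose k : ℝ) * (-1 : ℝ) ^ k * Real.exp (Real.sqrt (k : ℝ)))
        ~[atTop] fun n : ℕ => -1 / Real.sqrt (Real.pi * Real.log (n : ℝ))) ∧
    ((fun n : ℕ => ∑ k ∈ Finset.range (n + 1),
          (n.choose k : ℝ) * (-1 : ℝ) ^ k * Real.exp (-Real.sqrt (k : ℝ)))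
        ~[atTop] fun n : ℕ => 1 / Real.sqrt (Real.pi * Real.log (n : ℝ))) ∧
    ((fun n : ℕ => ∑ k ∈ Finset.Icc 1 n,
          (n.choose k : ℝ) * (-1 : ℝ) ^ k * Real.exp (1 / (k : ℝ)))
        ~[atTop] fun n : ℕ => -(Real.exp (2 * Real.sqrt (Real.log (n : ℝ))) /
          (2 * Real.sqrt Real.pi * Real.log (n : ℝ) ^ (1 / 4 : ℝ)))) ∧
    ((fun n : ℕ => (∑ k ∈ Finset.Icc 1 n,
          (n.choose k : ℝ) * (-1 : ℝ) ^ k * Real.exp (-(1 / (k : ℝ))))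
          - (-(Real.cos (2 * Real.sqrt (Real.log (n : ℝ)) - Real.pi / 4) /
              (Real.sqrt Real.pi * Real.log (n : ℝ) ^ (1 / 4 : ℝ)))))
        =o[atTop] fun n : ℕ => Real.log (n : ℝ) ^ (-(1 / 4) : ℝ)) := by
  have hq : ∀ n : ℕ, Real.log (n : ℝ) ^ (1 / 4 : ℝ) = Real.sqrt (Real.sqrt (Real.log n)) :=
    fun n => rpow_quarter_eq_sqrt_sqrt (Real.log_natCast_nonneg n)
  refine ⟨isEquivalent_sum_choose_exp_sqrt, isEquivalent_sum_choose_exp_neg_sqrt, ?_, ?_⟩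
  · have h := sum_choose_laplace halfExpOrder_besselI
      (laplace_of_hasSum abs_one fun t ht => hasSum_besselI_two_mul_sqrt (le_of_lt ht))
    simp only [one_mul] at h
    simp only [h, hq]
    exact isEquivalent_integral_besselI.neg
  · have h := sum_choose_laplace halfExpOrder_besselJ
      (laplace_of_hasSum (by simp) fun t ht => hasSum_besselJ_two_mul_sqrt (le_of_lt ht))
    simp only [neg_mul, one_mul] at h
    simp only [h, hq]
    refine (isLittleO_iff_tendsto' ?_).2 ?_
    · filter_upwards [tendsto_log_natCast_atTop.eventually_gt_atTop 0] with n hn h0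
      exact absurd h0 (Real.rpow_pos_of_pos hn _).ne'
    · have h1 := tendsto_integral_besselJ.neg
      rw [neg_zero] at h1
      refine h1.congr fun n => ?_
      rw [Real.rpow_neg (Real.log_natCast_nonneg n), hq, div_inv_eq_mul]
      ring
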